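/- Let $\mathcal C$ be a totally ordered set and let $A=\operatorname{Alg}(\mathcal C;[\![\_,\_]\!],\rhd)$ be the free real algebra on $\mathcal C$ with two bilinear operations $[\![\_,\_]\!]$ and $\rhd$. Monomials are graded by the number $|\cdot|_V$ of their generators (vertices), and $V_i\subset A$ is the span of the monomials with exactly $i$ vertices. Let $D(A)$ be the tensor algebra of $A$ with $\rhd$ extended by $1\rhd w=w$, $x\rhd 1=0$, $x\rhd(\omega_1\cdot\omega_2)=(x\rhd\omega_1)\cdot\omega_2+\omega_1\cdot(x\rhd\omega_2)$ and $(x\cdot\omega_1)\rhd\omega_2=x\rhd(\omega_1\rhd\omega_2)-(x\rhd\omega_1)\rhd\omega_2$ for $x\in A$. Put $[y,z]=y\cdot z-z\cdot y$, $[y,z,w]=[y,z]\rhd w=\big(y\rhd(z\rhd w)-(y\rhd z)\rhd w\big)-\big(z\rhd(y\rhd w)-(z\rhd y)\rhd w\big)$ and $\mathfrak s(x_1\cdots x_n)=\frac1{n!}\sum_{\sigma\in S_n}x_{\sigma^{-1}(1)}\cdots x_{\sigma^{-1}(n)}$ for $n\ge 0$. **The set $\hat S$.** Given a totally ordered set of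 elements, an OSBB-word is a product $\omega=\omega_1\cdots\omega_k$ ($k\ge1$) of blocks, where $\omega_i=\mathfrak s(x_1\cdots x_n)\cdot[y,z]$ with $n\geq 0$, $y\succ z$ and $x_j\succeq z$ for all $j$ when $i<k$, and $\omega_k=\mathfrak s(x_1\cdots x_n)$ with $n\ge0$ is a symmetric word. The set $\hat S$ with its total order $\prec$ is defined recursively: its elements are the elements $\omega\rhd r$, where $\omega$ is an OSBB-word (possibly empty) of elements of $\hat S$ and $r\in\mathcal C$ or $r=[\![u,v]\!]$ with $u,v\in\hat S$. To compare $\omega\rhd r$ and $\eta\rhd s$, compare successively: the numbers of vertices $|\omega\rhd r|_V$ and $|\eta\rhd s|_V$; $|\omega|_V$ and $|\eta|_V$; $\omega$ and $\eta$ in the order $\prec_\Delta$; the roots $r,s$ (by the order of $\mathcal C$ for generators, lexicographically for brackets). The order $\prec_\Delta$ compares first the lengths (numbers of letters), then the first blocks that differ. Two symmetric words are compared by length and then lexicographically after sorting their letters decreasingly. A symmetric-bracket block is larger than a symmetric word if and only if it is strictly longer. Two blocks $\mathfrak s(x_1\cdots x_n)\cdot[u,v]$ and $\mathfrak s(y_1\cdots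 y_m)\cdot[w,z]$ are compared by $n,m$, then $v,z$, then $u,w$, then their symmetric words. Here different such expressions denote different elements, and $\hat S$ is a basis of $A$ (this is part of the claim). **The map $\phi$.** Let $\phi:A\to A$ be the linear map given on the basis $\hat S$ recursively by $$\phi(c)=c,\qquad \phi([\![u,v]\!])=[\![\phi(u),\phi(v)]\!],\qquad \phi(\mathfrak s(x_1\cdots x_n)\rhd r)=\mathfrak s(\phi(x_1)\cdots\phi(x_n))\rhd\phi(r),$$ $$\phi(\omega\rhd r)=\mathfrak s(\phi(x_1)\cdots\phi(x_n))\rhd[\phi(y),\phi(z),\phi(\bar\omega\rhd r)]\quad\text{if }\omega=\mathfrak s(x_1\cdots x_n)\cdot[y,z]\cdot\bar\omega\text{ has at least two blocks}.$$ **The set $\mathcal T$.** Let $\mathcal T\subset A$ be the smallest set such that 1. $\mathcal C\subset\mathcal T$; 2. if $u,v\in\mathcal T$, then $[\![u,v]\!]\in\mathcal T$; 3. if $x_1,\dots,x_n\in\mathcal T$ ($n\ge0$) and $r\in\mathcal C$ or $r=[\![u,v]\!]$ with $u,v\in\mathcal T$, then $\mathfrak s(x_1\cdots x_n)\rhd r\in\mathcal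 T$; 4. if $x_1,\dots,x_n,y,z,w\in\mathcal T$ ($n\ge0$) with $y\succ_{\mathcal T}z$ and $x_i\succeq_{\mathcal T}z$ for all $i$, then $\mathfrak s(x_1\cdots x_n)\rhd[y,z,w]\in\mathcal T$, where $\phi(u)\succ_{\mathcal T}\phi(v)$ means $u\succ v$, for $u,v\in\hat S$. **Proposition.** $\hat S$ is a basis of $A$, and $\mathcal T$ is a basis of $A$. The linear map $\phi$ is an automorphism of the vector space $A$. It maps each $V_i$ onto itself, where $V_i$ is spanned by the elements of $\hat S$ with $i$ vertices, and it is upper-triangular there with unit diagonal: for each $x\in\hat S$, $\phi(x)-x$ is a linear combination of elements $y\in\hat S$ with $|y|_V=|x|_V$ and $y\prec x$. Finally, $\phi$ restricts to a bijection from $\hat S$ onto $\mathcal T$. -/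

import Mathlib

namespace TwoOpAlg

universe u v

/-- Monomials in the generators `C` and two binary operation symbols: the free set with two binary
operations on `C`. -/
inductive Mon (C : Type u) : Type u
  | gen (c : C) : Mon C
  | brk (s t : Mon C) : Mon C
  | tri (s t : Mon C) : Mon C

/-- The number of vertices of a monomial (its number of generators). -/
def Mon.vert {C : Type u} : Mon C → ℕ
  | .gen _ => 1
  | .brk s t => s.vert + t.vert
  | .tri s t => s.vert + t.vert

/-- The free real algebra on `C` with two bilinear operations: the real vector space on the
monomials, with the operations extended bilinearly. -/
abbrev A (C : Type u) : Type u := Mon C →₀ ℝ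

noncomputable section

variable {C : Type u}

/-- The generator of the free algebra attached to `c`. -/
def gen (c : C) : A C := Finsupp.single (Mon.gen c) 1

/-- The bilinear bracket `⟦x, y⟧`. -/
def brk : A C →ₗ[ℝ] A C →ₗ[ℝ] A C :=
  Finsupp.linearCombination ℝ fun s : Mon C => Finsupp.lmapDomain ℝ ℝ (Mon.brk s)

/-- The bilinear product `x ▷ y`. -/
def tri : A C →ₗ[ℝ] A C →ₗ[ℝ] A C :=
  Finsupp.linearCombination ℝ fun s : Mon C => Finsupp.lmapDomain ℝ ℝ (Mon.tri s)

/-- The triple bracket `[x, y, z] = a(x, y, z) - a(y, x, z)`, where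
`a(x, y, z) = x ▷ (y ▷ z) - (x ▷ y) ▷ z`. -/
def triple (x y z : A C) : A C :=
  (tri x (tri y z) - tri (tri x y) z) - (tri y (tri x z) - tri (tri y x) z)

/-- The vertex-graded piece of `A`: the span of the monomials with exactly `i` vertices. -/
def graded (C : Type u) (i : ℕ) : Submodule ℝ (A C) := Finsupp.supported ℝ ℝ {m : Mon C | m.vert = i}

lemma brk_single (s t : Mon C) :
    brk (Finsupp.single s 1) (Finsupp.single t 1) = Finsupp.single (Mon.brk s t) (1 : ℝ) := by
  simp [brk]

lemma tri_single (s t : Mon C) :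
    tri (Finsupp.single s 1) (Finsupp.single t 1) = Finsupp.single (Mon.tri s t) (1 : ℝ) := by
  simp [tri]

/-! ### The D-algebra of `A` -/

/-- The underlying space of the D-algebra: the tensor algebra of `A`. -/
abbrev D (C : Type u) : Type u := TensorAlgebra ℝ (A C)

/-- The inclusion of `A` in its tensor algebra. -/
abbrev inc : A C →ₗ[ℝ] D C := TensorAlgebra.ι ℝ

/-- The word `s₁ ⋯ sₙ` in the monomials. -/
def word (l : List (Mon C)) : D C := (l.map fun s => inc (Finsupp.single s 1)).prod

/-- The words form a basis of the tensor algebra. -/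
def wordBasis (C : Type u) : Module.Basis (FreeMonoid (Mon C)) ℝ (D C) :=
  (Finsupp.basisSingleOne : Module.Basis (Mon C) ℝ (A C)).tensorAlgebra

lemma wordBasis_apply (w : FreeMonoid (Mon C)) : wordBasis C w = word w.toList := by
  have key (v : FreeMonoid (Mon C)) : wordBasis C v =
      (TensorAlgebra.equivFreeAlgebra
        (Finsupp.basisSingleOne : Module.Basis (Mon C) ℝ (A C))).symm
        (FreeAlgebra.equivMonoidAlgebraFreeMonoid.symm (MonoidAlgebra.of ℝ _ v)) := rfl
  have keyOf (a : Mon C) : wordBasis C (FreeMonoid.of a) = inc (Finsupp.single a 1) := by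
    have := TensorAlgebra.equivFreeAlgebra_symm_ι
      (Finsupp.basisSingleOne : Module.Basis (Mon C) ℝ (A C)) a
    rw [Finsupp.coe_basisSingleOne] at this
    rw [key, ← this]
    congr 1
    simp [FreeAlgebra.equivMonoidAlgebraFreeMonoid]
  induction w using FreeMonoid.inductionOn' with
  | one => rw [key, map_one, map_one, map_one]; simp [word]
  | of_mul a w ih => rw [key, map_mul, map_mul, map_mul, ← key, ← key, ih, keyOf]; simp [word]

/-- The words obtained from a word by replacing one letter `t` by `s ▷ t`. -/
def graftAt (s : Mon C) : List (Mon C) → List (List (Mon C))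
  | [] => []
  | t :: l => (Mon.tri s t :: l) :: (graftAt s l).map (t :: ·)

lemma length_of_mem_graftAt {s : Mon C} {l l' : List (Mon C)} (h : l' ∈ graftAt s l) :
    l'.length = l.length := by
  induction l generalizing l' with
  | nil => simp [graftAt] at h
  | cons t l ih =>
    simp only [graftAt, List.mem_cons, List.mem_map] at h
    rcases h with rfl | ⟨m, hm, rfl⟩
    · simp
    · simp [ih hm]

/-- For `x` in `A`, the operator `x ▷ _` on the tensor algebra: it replaces the letters of a word
`t₁ ⋯ tₙ` by `x ▷ tᵢ`, one at a time, and adds up the results. -/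
def der : A C →ₗ[ℝ] D C →ₗ[ℝ] D C :=
  Finsupp.linearCombination ℝ fun s : Mon C =>
    (wordBasis C).constr ℝ fun w => ((graftAt s w.toList).map word).sum

section Extend

variable {N : Type v} [AddCommGroup N] [Module ℝ N]

/-- For operators `x ▷ _ = ρ x` on `N`, the operators `ω ▷ _` on `N` for words `ω`, by the recursion
`(x · ω) ▷ n = x ▷ (ω ▷ n) - (x ▷ ω) ▷ n`. -/
def extendWord (ρ : A C →ₗ[ℝ] N →ₗ[ℝ] N) : List (Mon C) → (N →ₗ[ℝ] N)
  | [] => LinearMap.id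
  | s :: l => ρ (Finsupp.single s 1) ∘ₗ extendWord ρ l -
      ((graftAt s l).attach.map fun m => extendWord ρ m.1).sum
termination_by l => l.length
decreasing_by
  · simp
  · simp [length_of_mem_graftAt m.2]

/-- The operators `ω ▷ _` on `N` for all `ω` in the tensor algebra. -/
def extend (ρ : A C →ₗ[ℝ] N →ₗ[ℝ] N) : D C →ₗ[ℝ] N →ₗ[ℝ] N :=
  (wordBasis C).constr ℝ fun w => extendWord ρ w.toList

end Extend

/-- The product `ω₁ ▷ ω₂` of the D-algebra of `A`. -/
def triD : D C →ₗ[ℝ] D C →ₗ[ℝ] D C := extend der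

/-- The product `ω ▷ r` of the D-algebra for `r` in `A`, as an element of `A`. -/
def act : D C →ₗ[ℝ] A C →ₗ[ℝ] A C := extend tri

/-! These are the defining laws of the product of the D-algebra. -/

lemma word_append (l m : List (Mon C)) : word (l ++ m) = word l * word m := by
  simp [word]

lemma word_cons (s : Mon C) (l : List (Mon C)) :
    word (s :: l) = inc (Finsupp.single s 1) * word l := by
  simp [word]

lemma der_single_word (s : Mon C) (l : List (Mon C)) :
    der (Finsupp.single s 1) (word l) = ((graftAt s l).map word).sum := by
  have := (wordBasis C).constr_basis ℝ
    (fun w => ((graftAt s w.toList).map word).sum) (FreeMonoid.ofList l)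
  rw [wordBasis_apply] at this
  simpa [der] using this

lemma sum_map_word_cons (t : Mon C) (L : List (List (Mon C))) :
    ((L.map (t :: ·)).map word).sum = inc (Finsupp.single t 1) * (L.map word).sum := by
  induction L with
  | nil => simp
  | cons l L ih =>
    simp only [List.map_cons, List.sum_cons, mul_add, ← ih, word_cons]

lemma der_word_append (s : Mon C) (l m : List (Mon C)) :
    der (Finsupp.single s 1) (word l * word m) =
      der (Finsupp.single s 1) (word l) * word m +
        word l * der (Finsupp.single s 1) (word m) := by
  induction l with
  | nil =>
    have := der_single_word s []
    simp only [graftAt, List.map_nil, List.sum_nil] at this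
    rw [this]
    simp [word]
  | cons t l ih =>
    rw [← word_append] at ih ⊢
    rw [List.cons_append]
    simp only [der_single_word, graftAt, List.map_cons, List.sum_cons, sum_map_word_cons] at ih ⊢
    rw [ih]
    simp only [word_cons, word_append]
    noncomm_ring

lemma extendWord_cons {N : Type v} [AddCommGroup N] [Module ℝ N] (ρ : A C →ₗ[ℝ] N →ₗ[ℝ] N)
    (s : Mon C) (l : List (Mon C)) :
    extendWord ρ (s :: l) = ρ (Finsupp.single s 1) ∘ₗ extendWord ρ l -
      ((graftAt s l).map fun m => extendWord ρ m).sum := by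
  rw [extendWord, List.attach_map_val (f := fun m => extendWord ρ m)]

lemma extend_word {N : Type v} [AddCommGroup N] [Module ℝ N] (ρ : A C →ₗ[ℝ] N →ₗ[ℝ] N)
    (l : List (Mon C)) : extend ρ (word l) = extendWord ρ l := by
  have := (wordBasis C).constr_basis ℝ (fun w => extendWord ρ w.toList) (FreeMonoid.ofList l)
  rwa [wordBasis_apply] at this

/-- A linear statement on the tensor algebra can be checked on words. -/
lemma word_induction {P : D C → Prop} (zero : P 0) (add : ∀ p q, P p → P q → P (p + q))
    (smul : ∀ (a : ℝ) p, P p → P (a • p)) (h : ∀ l, P (word l)) (p : D C) : P p := by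
  induction (wordBasis C).mem_span p using Submodule.span_induction with
  | mem x hx => obtain ⟨w, rfl⟩ := hx; rw [wordBasis_apply]; exact h _
  | zero => exact zero
  | add x y _ _ hx hy => exact add x y hx hy
  | smul a x _ hx => exact smul a x hx

/-- A linear statement on `A` can be checked on monomials. -/
lemma mon_induction {P : A C → Prop} (zero : P 0) (add : ∀ p q, P p → P q → P (p + q))
    (smul : ∀ (a : ℝ) p, P p → P (a • p)) (h : ∀ s, P (Finsupp.single s 1)) (p : A C) : P p := by
  induction p using Finsupp.induction_linear with
  | zero => exact zero
  | add p q hp hq => exact add p q hp hq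
  | single s a => simpa using smul a _ (h s)

/-- `x ▷ (ω₁ · ω₂) = (x ▷ ω₁) · ω₂ + ω₁ · (x ▷ ω₂)`. -/
theorem der_mul (x : A C) (p q : D C) : der x (p * q) = der x p * q + p * der x q := by
  induction x using mon_induction with
  | zero => simp
  | add x y hx hy => simp only [map_add, LinearMap.add_apply, hx, hy]; noncomm_ring
  | smul a x hx => simp [hx]
  | h s =>
    induction p using word_induction with
    | zero => simp
    | add x y hx hy => simp only [map_add, add_mul, hx, hy]; abel
    | smul a x hx => simp [hx]
    | h l =>
      induction q using word_induction with
      | zero => simp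
      | add x y hx hy => simp only [map_add, mul_add, hx, hy]; abel
      | smul a x hx => simp [hx]
      | h m => exact der_word_append s l m

/-- `x ▷ y` in the D-algebra is `x ▷ y` in `A`. -/
theorem der_inc (x y : A C) : der x (inc y) = inc (tri x y) := by
  induction x using mon_induction with
  | zero => simp
  | add x y hx hy => simp [hx, hy]
  | smul a x hx => simp [hx]
  | h s =>
    induction y using mon_induction with
    | zero => simp
    | add x y hx hy => simp [hx, hy]
    | smul a x hx => simp [hx]
    | h t =>
      have := der_single_word s [t]
      simpa [word, graftAt, tri_single] using this

theorem extend_one {N : Type v} [AddCommGroup N] [Module ℝ N] (ρ : A C →ₗ[ℝ] N →ₗ[ℝ] N) (n : N) :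
    extend ρ 1 n = n := by
  have := extend_word ρ ([] : List (Mon C))
  simp only [word, List.map_nil, List.prod_nil] at this
  simp [this, extendWord]

/-- `(x · ω) ▷ n = x ▷ (ω ▷ n) - (x ▷ ω) ▷ n`. -/
theorem extend_inc_mul {N : Type v} [AddCommGroup N] [Module ℝ N] (ρ : A C →ₗ[ℝ] N →ₗ[ℝ] N)
    (x : A C) (p : D C) (n : N) :
    extend ρ (inc x * p) n = ρ x (extend ρ p n) - extend ρ (der x p) n := by
  induction x using mon_induction with
  | zero => simp
  | add x y hx hy => simp only [map_add, add_mul, LinearMap.add_apply, hx, hy]; abel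
  | smul a x hx => simp [hx, smul_sub]
  | h s =>
    induction p using word_induction with
    | zero => simp
    | add x y hx hy => simp only [map_add, mul_add, LinearMap.add_apply, hx, hy]; abel
    | smul a x hx => simp [hx, smul_sub]
    | h l =>
      have h : extend ρ (der (Finsupp.single s 1) (word l)) =
          ((graftAt s l).map fun m => extendWord ρ m).sum := by
        rw [der_single_word, map_list_sum, List.map_map]
        congr 1
        exact List.map_congr_left fun m _ => extend_word ρ m
      rw [← word_cons, h, extend_word, extend_word, extendWord_cons]
      rfl

theorem triD_inc (x : A C) (p : D C) : triD (inc x) p = der x p := by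
  have h := extend_inc_mul der x 1 p
  have h1 : der x (1 : D C) = 0 := by
    have := der_mul x (1 : D C) 1
    simpa using this
  rw [mul_one, extend_one, h1] at h
  simpa [triD] using h

/-- The product `ω ▷ r` of the D-algebra stays in `A` for `r` in `A`. -/
theorem triD_inc_right (p : D C) (r : A C) : triD p (inc r) = inc (act p r) := by
  induction p using word_induction with
  | zero => simp
  | add x y hx hy => simp [hx, hy]
  | smul a x hx => simp [hx]
  | h l =>
    rw [triD, act, extend_word, extend_word]
    induction hn : l.length using Nat.strong_induction_on generalizing l r with
    | _ n ih =>
      cases l with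
      | nil => simp [extendWord]
      | cons s l =>
        subst hn
        have h (L : List (List (Mon C))) (hL : ∀ m ∈ L, m.length = l.length) :
            (L.map fun m => extendWord der m).sum (inc r) =
              inc ((L.map fun m => extendWord tri m).sum r) := by
          induction L with
          | nil => simp
          | cons m L ihL =>
            simp only [List.map_cons, List.sum_cons, LinearMap.add_apply, map_add]
            rw [ihL fun m' hm' => hL m' (List.mem_cons_of_mem _ hm'),
              ih m.length (by simp [hL m]) r m rfl]
        simp only [extendWord_cons, LinearMap.sub_apply, LinearMap.comp_apply, map_sub]
        rw [h _ fun m hm => length_of_mem_graftAt hm, ih l.length (by simp) r l rfl, der_inc]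

/-! ### Symmetrization -/

/-- The symmetric word `𝔰(x₁ ⋯ xₙ) = (1 / n!) ∑_σ x_{σ⁻¹(1)} ⋯ x_{σ⁻¹(n)}`. -/
def symWord {n : ℕ} (x : Fin n → A C) : D C :=
  ((n.factorial : ℝ)⁻¹) • ∑ σ : Equiv.Perm (Fin n), (List.ofFn fun i => inc (x (σ⁻¹ i))).prod

/-- The bracket `[y, z] = y · z - z · y` in the tensor algebra. -/
def comm (y z : A C) : D C := inc y * inc z - inc z * inc y

/-- `[y, z] ▷ w` is the triple bracket `[y, z, w]`. -/
theorem act_comm (y z w : A C) : act (comm y z) w = triple y z w := by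
  have h (x y : A C) : act (inc x * inc y) w = tri x (tri y w) - tri (tri x y) w := by
    have h1 (x : A C) : act (inc x) w = tri x w := by
      have h := extend_inc_mul tri x 1 w
      have h1 : der x (1 : D C) = 0 := by
        have := der_mul x (1 : D C) 1
        simpa using this
      rw [mul_one, extend_one, h1] at h
      simpa [act] using h
    have h := extend_inc_mul tri x (inc y) w
    rw [der_inc] at h
    change act (inc x * inc y) w = tri x (act (inc y) w) - act (inc (tri x y)) w at h
    rwa [h1, h1] at h
  simp only [comm, map_sub, LinearMap.sub_apply, h, triple]

end

/-! ### Formal expressions for the elements of `Ŝ` -/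

mutual

/-- Formal expressions `ω ▷ r`. -/
inductive Expr (C : Type u) : Type u
  | mk (ω : Osbb C) (r : Root C) : Expr C

/-- Formal roots: a generator `c`, or a bracket `⟦u, v⟧`. -/
inductive Root (C : Type u) : Type u
  | gen (c : C) : Root C
  | brk (u v : Expr C) : Root C

/-- Formal block words: a symmetric word `𝔰(x₁ ⋯ xₙ)` (possibly empty), or a symmetric-bracket word
`𝔰(x₁ ⋯ xₙ) · [y, z]` followed by a block word. -/
inductive Osbb (C : Type u) : Type u
  | sym (xs : Exprs C) : Osbb C
  | block (xs : Exprs C) (y z : Expr C) (ω : Osbb C) : Osbb C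

/-- Lists `x₁, …, xₙ` of formal expressions. -/
inductive Exprs (C : Type u) : Type u
  | nil : Exprs C
  | cons (x : Expr C) (xs : Exprs C) : Exprs C

end

section

variable {C : Type u}

/-- The underlying list. -/
def Exprs.toList : Exprs C → List (Expr C)
  | .nil => []
  | .cons x xs => x :: xs.toList

/-- The number of letters. -/
def Exprs.length : Exprs C → ℕ
  | .nil => 0
  | .cons _ xs => xs.length + 1

/-- The length `l(ω)`. -/
def Osbb.length : Osbb C → ℕ
  | .sym xs => xs.length
  | .block xs _ _ ω => xs.length + 2 + ω.length

mutual

/-- The number of vertices. -/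
def Expr.vert : Expr C → ℕ
  | .mk ω r => ω.vert + r.vert

/-- The number of vertices. -/
def Root.vert : Root C → ℕ
  | .gen _ => 1
  | .brk u v => u.vert + v.vert

/-- The number of vertices. -/
def Osbb.vert : Osbb C → ℕ
  | .sym xs => xs.vert
  | .block xs y z ω => xs.vert + y.vert + z.vert + ω.vert

/-- The number of vertices. -/
def Exprs.vert : Exprs C → ℕ
  | .nil => 0
  | .cons x xs => x.vert + xs.vert

end

mutual

/-- The order on expressions: first the number of vertices, then `|ω|_V`, then the order `≺_Δ` on
block words (first the length, then the first block that differs), then the root. -/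
def Expr.lt [LT C] : Expr C → Expr C → Prop
  | .mk ω r, .mk η s =>
    (Expr.mk ω r).vert < (Expr.mk η s).vert ∨
    ((Expr.mk ω r).vert = (Expr.mk η s).vert ∧
      (ω.vert < η.vert ∨
        (ω.vert = η.vert ∧ (ω.length < η.length ∨ (ω.length = η.length ∧ ω.blockLt η))) ∨
        (ω = η ∧ r.lt s)))

/-- The order on roots with the same number of vertices: by the order of `C` on generators,
lexicographically on brackets. A generator (one vertex) comes before a bracket (at least two). -/
def Root.lt [LT C] : Root C → Root C → Prop
  | .gen c, .gen d => c < d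
  | .gen _, .brk _ _ => True
  | .brk _ _, .gen _ => False
  | .brk u v, .brk w z => u.lt w ∨ (u = w ∧ v.lt z)

/-- The comparison of block words of the same length at the first block that differs.
* Two symmetric words: first the length, then lexicographically.
* A symmetric word is smaller than a symmetric-bracket word exactly if it is strictly shorter.
* Two symmetric-bracket words `𝔰(x₁ ⋯ xₙ) · [u, v]` and `𝔰(y₁ ⋯ yₘ) · [w, z]`: first `n` and `m`,
  then `v` and `z`, then `u` and `w`, then the symmetric words. -/
def Osbb.blockLt [LT C] : Osbb C → Osbb C → Prop
  | .sym xs, .sym ys => xs.length < ys.length ∨ (xs.length = ys.length ∧ xs.lexLt ys)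
  | .sym xs, .block ys _ _ _ => xs.length < ys.length + 2
  | .block xs _ _ _, .sym ys => ¬ ys.length < xs.length + 2
  | .block xs u v ω, .block ys w z η =>
    (xs.length < ys.length ∨
      (xs.length = ys.length ∧
        (v.lt z ∨ (v = z ∧ (u.lt w ∨ (u = w ∧ xs.lexLt ys)))))) ∨
    (xs = ys ∧ u = w ∧ v = z ∧ ω.blockLt η)

/-- The lexicographic order on lists of the same length. -/
def Exprs.lexLt [LT C] : Exprs C → Exprs C → Prop
  | .nil, _ => False
  | .cons _ _, .nil => False
  | .cons x xs, .cons y ys => x.lt y ∨ (x = y ∧ xs.lexLt ys)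

end

/-- `x ≼ y`. -/
def Expr.le [LT C] (x y : Expr C) : Prop := x.lt y ∨ x = y

mutual

theorem Expr.lt_irrefl [LinearOrder C] (x : Expr C) : ¬ x.lt x := by
  obtain ⟨ω, r⟩ := x
  have h1 := Osbb.blockLt_irrefl ω
  have h2 := Root.lt_irrefl r
  simp [Expr.lt, h1, h2]

theorem Root.lt_irrefl [LinearOrder C] (r : Root C) : ¬ r.lt r := by
  cases r with
  | gen c => simp [Root.lt]
  | brk u v =>
    have h1 := Expr.lt_irrefl u
    have h2 := Expr.lt_irrefl v
    simp [Root.lt, h1, h2]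

theorem Osbb.blockLt_irrefl [LinearOrder C] (ω : Osbb C) : ¬ ω.blockLt ω := by
  cases ω with
  | sym xs =>
    have h1 := Exprs.lexLt_irrefl xs
    simp [Osbb.blockLt, h1]
  | block xs y z ω =>
    have h1 := Exprs.lexLt_irrefl xs
    have h2 := Expr.lt_irrefl y
    have h3 := Expr.lt_irrefl z
    have h4 := Osbb.blockLt_irrefl ω
    simp [Osbb.blockLt, h1, h2, h3, h4]

theorem Exprs.lexLt_irrefl [LinearOrder C] (xs : Exprs C) : ¬ xs.lexLt xs := by
  cases xs with
  | nil => simp [Exprs.lexLt]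
  | cons x xs =>
    have h1 := Expr.lt_irrefl x
    have h2 := Exprs.lexLt_irrefl xs
    simp [Exprs.lexLt, h1, h2]

end

mutual

theorem Expr.lt_trichotomy [LinearOrder C] (x y : Expr C) : x.lt y ∨ x = y ∨ y.lt x := by
  obtain ⟨ω, r⟩ := x
  obtain ⟨η, s⟩ := y
  have h1 := Osbb.blockLt_trichotomy ω η
  have h2 := Root.lt_trichotomy r s
  simp only [Expr.lt, Expr.mk.injEq]
  grind

theorem Root.lt_trichotomy [LinearOrder C] (r s : Root C) : r.lt s ∨ r = s ∨ s.lt r := by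
  cases r with
  | gen c =>
    cases s with
    | gen d => simpa [Root.lt] using _root_.lt_trichotomy c d
    | brk w z => simp [Root.lt]
  | brk u v =>
    cases s with
    | gen d => simp [Root.lt]
    | brk w z =>
      have h1 := Expr.lt_trichotomy u w
      have h2 := Expr.lt_trichotomy v z
      simp only [Root.lt, Root.brk.injEq]
      grind

theorem Osbb.blockLt_trichotomy [LinearOrder C] (ω η : Osbb C) :
    ω.blockLt η ∨ ω = η ∨ η.blockLt ω := by
  cases ω with
  | sym xs =>
    cases η with
    | sym ys =>
      have h1 := Exprs.lexLt_trichotomy xs ys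
      simp only [Osbb.blockLt, Osbb.sym.injEq]
      grind
    | block ys w z η => simp only [Osbb.blockLt]; grind
  | block xs u v ω =>
    cases η with
    | sym ys => simp only [Osbb.blockLt]; grind
    | block ys w z η =>
      have h1 := Exprs.lexLt_trichotomy xs ys
      have h2 := Expr.lt_trichotomy u w
      have h3 := Expr.lt_trichotomy v z
      have h4 := Osbb.blockLt_trichotomy ω η
      simp only [Osbb.blockLt, Osbb.block.injEq]
      grind

theorem Exprs.lexLt_trichotomy [LinearOrder C] (xs ys : Exprs C) :
    xs.length = ys.length → xs.lexLt ys ∨ xs = ys ∨ ys.lexLt xs := by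
  cases xs with
  | nil => cases ys <;> simp [Exprs.length]
  | cons x xs =>
    cases ys with
    | nil => simp [Exprs.length]
    | cons y ys =>
      have h1 := Expr.lt_trichotomy x y
      have h2 := Exprs.lexLt_trichotomy xs ys
      simp only [Exprs.lexLt, Exprs.cons.injEq, Exprs.length]
      grind

end

mutual

theorem Expr.lt_trans [LinearOrder C] (x y z : Expr C) : x.lt y → y.lt z → x.lt z := by
  obtain ⟨ω, r⟩ := x
  obtain ⟨η, s⟩ := y
  obtain ⟨θ, t⟩ := z
  have h1 := Osbb.blockLt_trans ω η θ
  have h2 := Root.lt_trans r s t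
  simp only [Expr.lt]
  grind

theorem Root.lt_trans [LinearOrder C] (r s t : Root C) : r.lt s → s.lt t → r.lt t := by
  cases r with
  | gen c =>
    cases s with
    | gen d =>
      cases t with
      | gen e => simpa [Root.lt] using fun h h' => _root_.lt_trans h h'
      | brk _ _ => simp [Root.lt]
    | brk w z => cases t <;> simp [Root.lt]
  | brk u v =>
    cases s with
    | gen d => simp [Root.lt]
    | brk w z =>
      cases t with
      | gen e => simp [Root.lt]
      | brk p q =>
        have h1 := Expr.lt_trans u w p
        have h2 := Expr.lt_trans v z q
        simp only [Root.lt]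
        grind

theorem Osbb.blockLt_trans [LinearOrder C] (ω η θ : Osbb C) :
    ω.blockLt η → η.blockLt θ → ω.blockLt θ := by
  cases ω with
  | sym xs =>
    cases η with
    | sym ys =>
      cases θ with
      | sym zs =>
        have h1 := Exprs.lexLt_trans xs ys zs
        simp only [Osbb.blockLt]
        grind
      | block zs p q θ => simp only [Osbb.blockLt]; grind
    | block ys w z η => cases θ <;> simp only [Osbb.blockLt] <;> grind
  | block xs u v ω =>
    cases η with
    | sym ys => cases θ <;> simp only [Osbb.blockLt] <;> grind
    | block ys w z η =>
      cases θ with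
      | sym zs => simp only [Osbb.blockLt]; grind
      | block zs p q θ =>
        have h1 := Exprs.lexLt_trans xs ys zs
        have h2 := Expr.lt_trans u w p
        have h3 := Expr.lt_trans v z q
        have h4 := Osbb.blockLt_trans ω η θ
        simp only [Osbb.blockLt]
        grind

theorem Exprs.lexLt_trans [LinearOrder C] (xs ys zs : Exprs C) :
    xs.lexLt ys → ys.lexLt zs → xs.lexLt zs := by
  cases xs with
  | nil => simp [Exprs.lexLt]
  | cons x xs =>
    cases ys with
    | nil => simp [Exprs.lexLt]
    | cons y ys =>
      cases zs with
      | nil => simp [Exprs.lexLt]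
      | cons z zs =>
        have h1 := Expr.lt_trans x y z
        have h2 := Exprs.lexLt_trans xs ys zs
        simp only [Exprs.lexLt]
        grind

end

/-- The order on expressions is a strict total order. -/
instance Expr.isStrictTotalOrder [LinearOrder C] : IsStrictTotalOrder (Expr C) Expr.lt where
  irrefl := Expr.lt_irrefl
  trans := Expr.lt_trans
  trichotomous x y h h' := by
    rcases Expr.lt_trichotomy x y with h1 | h1 | h1
    · exact absurd h1 h
    · exact h1
    · exact absurd h1 h'

mutual

/-- The expressions `ω ▷ r` that define elements of `Ŝ`: `ω` is an OSBB-word of such expressions,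
and `r` is a generator or a bracket of two such expressions. -/
def Expr.Valid [LT C] : Expr C → Prop
  | .mk ω r => ω.Valid ∧ r.Valid

/-- `r` is a generator or a bracket of two valid expressions. -/
def Root.Valid [LT C] : Root C → Prop
  | .gen _ => True
  | .brk u v => u.Valid ∧ v.Valid

/-- OSBB-words: every block `𝔰(x₁ ⋯ xₙ) · [y, z]` satisfies `z ≺ y` and `z ≼ xᵢ` for all `i`. The
letters of a symmetric word, which commute, are listed in weakly decreasing order. -/
def Osbb.Valid [LT C] : Osbb C → Prop
  | .sym xs => xs.Valid ∧ xs.toList.Pairwise (fun a b => b.le a)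
  | .block xs y z ω =>
    (xs.Valid ∧ xs.toList.Pairwise (fun a b => b.le a)) ∧
    (y.Valid ∧ z.Valid ∧ z.lt y ∧ ∀ x ∈ xs.toList, z.le x) ∧
    ω.Valid

/-- All members of the list are valid. -/
def Exprs.Valid [LT C] : Exprs C → Prop
  | .nil => True
  | .cons x xs => x.Valid ∧ xs.Valid

end

noncomputable section

mutual

/-- The element `ω ▷ r` of `A`. -/
def Expr.eval : Expr C → A C
  | .mk ω r => act ω.eval r.eval

/-- The element of `A` given by a root. -/
def Root.eval : Root C → A C
  | .gen c => TwoOpAlg.gen c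
  | .brk u v => TwoOpAlg.brk u.eval v.eval

/-- The element `𝔰(x₁ ⋯ xₙ)` or `𝔰(x₁ ⋯ xₙ) · [y, z] · ω` of the tensor algebra. -/
def Osbb.eval : Osbb C → D C
  | .sym xs => symWord xs.eval.get
  | .block xs y z ω => symWord xs.eval.get * comm y.eval z.eval * ω.eval

/-- The list of elements of `A`. -/
def Exprs.eval : Exprs C → List (A C)
  | .nil => []
  | .cons x xs => x.eval :: xs.eval

end

mutual

/-- The map `φ` on expressions:
* `φ(c) = c` and `φ(⟦u, v⟧) = ⟦φ(u), φ(v)⟧`,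
* `φ(𝔰(x₁ ⋯ xₙ) ▷ r) = 𝔰(φ(x₁) ⋯ φ(xₙ)) ▷ φ(r)`,
* `φ((𝔰(x₁ ⋯ xₙ) · [y, z] · ω) ▷ r) = 𝔰(φ(x₁) ⋯ φ(xₙ)) ▷ [φ(y), φ(z), φ(ω ▷ r)]`. -/
def Expr.phi : Expr C → A C
  | .mk ω r => ω.phi r.phi

/-- `φ` on roots. -/
def Root.phi : Root C → A C
  | .gen c => TwoOpAlg.gen c
  | .brk u v => TwoOpAlg.brk u.phi v.phi

/-- `φ(ω ▷ r)` as a function of `φ(r)`. -/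
def Osbb.phi : Osbb C → A C → A C
  | .sym xs, a => act (symWord xs.phi.get) a
  | .block xs y z ω, a => act (symWord xs.phi.get) (triple y.phi z.phi (ω.phi a))

/-- `φ` on the members of a list. -/
def Exprs.phi : Exprs C → List (A C)
  | .nil => []
  | .cons x xs => x.phi :: xs.phi

end

lemma Expr.phi_sym (xs : Exprs C) (r : Root C) :
    (Expr.mk (.sym xs) r).phi = act (symWord xs.phi.get) r.phi := by
  simp only [Expr.phi, Osbb.phi]

lemma Expr.phi_block (xs : Exprs C) (y z : Expr C) (ω : Osbb C) (r : Root C) :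
    (Expr.mk (.block xs y z ω) r).phi =
      act (symWord xs.phi.get) (triple y.phi z.phi (Expr.mk ω r).phi) := by
  simp only [Expr.phi, Osbb.phi]

/-- The index set of `Ŝ`. The set `Ŝ` is the set of the values `x.1.eval` for `x : Shat C`. -/
abbrev Shat (C : Type u) [LT C] : Type u := {x : Expr C // x.Valid}

/-- The order on values of `φ` carried over from `Ŝ`: `φ(u) ≺ φ(v)` if `u ≺ v`. -/
def ltT [LT C] (a b : A C) : Prop :=
  ∃ u v : Shat C, u.1.phi = a ∧ v.1.phi = b ∧ u.1.lt v.1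

/-- Membership in `𝒯`. -/
inductive MemT [LT C] : A C → Prop
  | gen (c : C) : MemT (TwoOpAlg.gen c)
  | brk (u v : A C) : MemT u → MemT v → MemT (TwoOpAlg.brk u v)
  | symGen (n : ℕ) (x : Fin n → A C) (c : C) : (∀ i, MemT (x i)) →
      MemT (act (symWord x) (TwoOpAlg.gen c))
  | symBrk (n : ℕ) (x : Fin n → A C) (u v : A C) : (∀ i, MemT (x i)) → MemT u → MemT v →
      MemT (act (symWord x) (TwoOpAlg.brk u v))
  | symTriple (n : ℕ) (x : Fin n → A C) (y z w : A C) : (∀ i, MemT (x i)) →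
      MemT y → MemT z → MemT w → ltT z y → (∀ i, ltT z (x i) ∨ z = x i) →
      MemT (act (symWord x) (triple y z w))

/-- The set `𝒯`. -/
def T (C : Type u) [LT C] : Set (A C) := {a | MemT a}

end

end

end TwoOpAlg

-- Everything is graded by content, the multiset of generators occurring in a monomial. Both
-- operations and the action `act` respect it, and only finitely many monomials have a given
-- content, so the argument takes place in finite-dimensional pieces even when `C` is infinite.
--
-- Spanning. Unrolling `x ▷ (ω ▷ r) = (x · ω) ▷ r + (x ▷ ω) ▷ r` writes each monomial as a
-- combination of words acting on roots (`single_mem_span_act`). By induction on vertices the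
-- letters may be taken in `Ŝ`. A word is its symmetrization plus products containing a bracket. The
-- Jacobi identity lets the smallest letter of `𝔰(u) · [a, b]` be moved into the lower slot of the
-- bracket, up to terms with a shorter symmetric part (`straighten`). Iterating along the word gives
-- OSBB-words (`list_prod_mem_osbbSpan`).
--
-- Independence. List the letters of a block as `x₁ ≽ ⋯ ≽ xₙ ≽ z ≺ y`: the block ends at the first
-- ascent. An OSBB-word is therefore determined by its word of letters, and sending `(x₁ ⋯ xₙ) ▷ r`
-- to the monomial `x₁ ▷ (⋯ (xₙ ▷ r))` recursively is an injection from `Ŝ` to the monomials that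
-- preserves content (`Expr.mon_injOn`). Hence any family indexed by `Ŝ` that spans every content
-- piece has at most as many members there as the dimension, and is independent
-- (`linearIndependent_of_span`). This applies to `Ŝ` and later to `φ(Ŝ)`.
--
-- Triangularity. Composition `p ▷ (q ▷ a)` equals `(p · q) ▷ a` up to shorter words
-- (`exists_act_act_eq`), and shorter words are lower in the order. So `𝔰(x) ▷ [y, z, ω ▷ r]` has
-- leading term `(𝔰(x) · [y, z] · ω) ▷ r`. Replacing each argument by its `φ`-image adds, by
-- induction and multilinearity, terms with lowered arguments. Lowering an argument can spoil the
-- order condition on the first block, but straightening then yields either a shorter symmetric part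
-- or a smaller lower bracket letter, which are exactly the first comparisons in the order on blocks
-- (`act_block_mem_lowSpan`). This gives `phi_sub_eval_mem`. Inverting the unitriangular map within
-- a content piece shows that `φ(Ŝ)` spans; it is thus a basis, and `φ(Ŝ) = 𝒯` by matching the rules
-- of `𝒯` with the cases of `φ`.

namespace TwoOpAlg

universe u

noncomputable section

/-! ### Symmetrized products and straightening -/

section Symmetrize

variable {R : Type*} [Ring R] [Algebra ℝ R] {X : Type*}

/-- The symmetrized product of a finite sequence. -/
def symProd {n : ℕ} (x : Fin n → R) : R :=
  ((n.factorial : ℝ)⁻¹) • ∑ σ : Equiv.Perm (Fin n), (List.ofFn fun i => x (σ⁻¹ i)).prod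

/-- The symmetrized product of a list. -/
def symList (l : List R) : R := symProd l.get

lemma symProd_eq_symList {n : ℕ} (x : Fin n → R) : symProd x = symList (List.ofFn x) := by
  have h : (⟨n, x⟩ : Σ n, Fin n → R) = ⟨_, (List.ofFn x).get⟩ := by
    rw [← List.ofFn_inj', List.ofFn_get]
  exact congrArg (fun p : Σ n, Fin n → R => symProd p.2) h

lemma symProd_comp_perm {n : ℕ} (x : Fin n → R) (τ : Equiv.Perm (Fin n)) :
    symProd (x ∘ τ) = symProd x := by
  unfold symProd
  congr 1
  rw [← Equiv.sum_comp (Equiv.mulRight τ)]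
  simp

/-- Each value is taken equally often by both sequences, so the fibres over it are in bijection;
gluing these bijections gives the permutation. -/
lemma exists_perm_of_ofFn_perm {n : ℕ} (x y : Fin n → X) (h : (List.ofFn x).Perm (List.ofFn y)) :
    ∃ σ : Equiv.Perm (Fin n), y ∘ σ = x := by
  classical
  have h1 : Finset.univ.val.map x = Finset.univ.val.map y := by
    rw [Fin.univ_val_map, Fin.univ_val_map]
    exact Multiset.coe_eq_coe.2 h
  have h2 (a : X) : Nonempty ({i // x i = a} ≃ {i // y i = a}) := by
    refine ⟨Fintype.equivOfCardEq ?_⟩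
    have := congrArg (Multiset.count a) h1
    rw [Multiset.count_map, Multiset.count_map, ← Finset.filter_val, ← Finset.filter_val] at this
    simpa only [Fintype.card_subtype, Finset.card_def, eq_comm] using this
  have e (a : X) := Classical.choice (h2 a)
  refine ⟨(Equiv.sigmaFiberEquiv x).symm.trans
    ((Equiv.sigmaCongrRight fun a => (e a)).trans (Equiv.sigmaFiberEquiv y)), ?_⟩
  funext i
  exact (e (x i) ⟨i, rfl⟩).2

lemma symList_perm {l l' : List R} (h : l.Perm l') : symList l = symList l' := by
  have key {n : ℕ} (x y : Fin n → R) (h : (List.ofFn x).Perm (List.ofFn y)) :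
      symList (List.ofFn x) = symList (List.ofFn y) := by
    obtain ⟨σ, rfl⟩ := exists_perm_of_ofFn_perm x y h
    rw [← symProd_eq_symList, ← symProd_eq_symList, symProd_comp_perm]
  have h1 : List.ofFn (fun i : Fin l.length => l'.get (i.cast h.length_eq)) = l' :=
    List.ext_get (by simp [h.length_eq]) (by simp)
  have h2 := key l.get (fun i : Fin l.length => l'.get (i.cast h.length_eq))
    (by rwa [List.ofFn_get, h1])
  rwa [List.ofFn_get, h1] at h2

lemma symList_map (f : X → R) (l : List X) :
    symList (l.map f) = symProd fun i => f (l.get i) := by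
  rw [symProd_eq_symList]
  congr 1
  conv_lhs => rw [← List.ofFn_get l, List.map_ofFn]
  rfl

/-- The symmetrized product is the average of the products of the rearrangements, so the difference
is the average of differences that lie in `N`. -/
lemma sub_symList_mem (N : Submodule ℝ R) (f : X → R) (a : R) (l : List X)
    (h : ∀ l' : List X, l'.Perm l → a - (l'.map f).prod ∈ N) : a - symList (l.map f) ∈ N := by
  have h2 : a - symList (l.map f) = ((l.length.factorial : ℝ)⁻¹) •
      ∑ σ : Equiv.Perm (Fin l.length), (a - (List.ofFn fun i => f (l.get (σ⁻¹ i))).prod) := by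
    rw [Finset.sum_sub_distrib, smul_sub, symList_map, symProd]
    congr 1
    rw [Finset.sum_const, Finset.card_univ, Fintype.card_perm, Fintype.card_fin,
      ← Nat.cast_smul_eq_nsmul ℝ, smul_smul, inv_mul_cancel₀, one_smul]
    exact_mod_cast Nat.factorial_ne_zero _
  rw [h2]
  refine N.smul_mem _ (N.sum_mem fun σ _ => ?_)
  have h3 := h (List.ofFn (l.get ∘ ⇑(σ⁻¹))) (by
    have := Equiv.Perm.ofFn_comp_perm σ⁻¹ l.get
    rwa [List.ofFn_get] at this)
  rwa [List.map_ofFn] at h3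

lemma symList_nil : symList ([] : List R) = 1 := by
  simp [symList, symProd]

lemma symWord_get (l : List (A X)) : symWord l.get = symList (l.map inc) := by
  have : symWord l.get = symProd fun i => inc (l.get i) := rfl
  rw [this, symProd_eq_symList]
  congr 1
  conv_rhs => rw [← List.ofFn_get l, List.map_ofFn]
  rfl

end Symmetrize

-- Straightening products into ordered blocks

section Straighten

variable {R : Type*} [Ring R] [Algebra ℝ R] {X : Type*} (f : X → R)

/-- The span of the products `u · [a, b] · v` of words with fewer than `j` letters in `u`, with a
prescribed multiset of letters. -/
def wordBracketSpan (j : ℕ) (l : List X) : Submodule ℝ R :=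
  Submodule.span ℝ {p | ∃ u a b v, u.length < j ∧ (u ++ a :: b :: v).Perm l ∧
    (u.map f).prod * (f a * f b - f b * f a) * (v.map f).prod = p}

/-- The span of the products `𝔰(u) · [a, b] · v` with fewer than `j` letters in `u`. -/
def symBracketSpan (j : ℕ) (l : List X) : Submodule ℝ R :=
  Submodule.span ℝ {p | ∃ u a b v, u.length < j ∧ (u ++ a :: b :: v).Perm l ∧
    symList (u.map f) * (f a * f b - f b * f a) * (v.map f).prod = p}

variable {f}

lemma wordBracketSpan_mono {j k : ℕ} (h : j ≤ k) {l l' : List X} (hl : l.Perm l') :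
    wordBracketSpan f j l ≤ wordBracketSpan f k l' :=
  Submodule.span_mono fun _ ⟨u, a, b, v, h1, h2, h3⟩ =>
    ⟨u, a, b, v, h1.trans_le h, h2.trans hl, h3⟩

lemma symBracketSpan_mono {j k : ℕ} (h : j ≤ k) {l l' : List X} (hl : l.Perm l') :
    symBracketSpan f j l ≤ symBracketSpan f k l' :=
  Submodule.span_mono fun _ ⟨u, a, b, v, h1, h2, h3⟩ =>
    ⟨u, a, b, v, h1.trans_le h, h2.trans hl, h3⟩

lemma mul_mem_wordBracketSpan {j : ℕ} {l : List X} (x : X) {p : R}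
    (hp : p ∈ wordBracketSpan f j l) : f x * p ∈ wordBracketSpan f (j + 1) (x :: l) := by
  induction hp using Submodule.span_induction with
  | mem p hp =>
    obtain ⟨u, a, b, v, h1, h2, rfl⟩ := hp
    refine Submodule.subset_span ⟨x :: u, a, b, v, by simpa using h1, by simpa using h2, ?_⟩
    simp [mul_assoc]
  | zero => simp
  | add p q _ _ hp hq => rw [mul_add]; exact add_mem hp hq
  | smul c p _ hp => rw [mul_smul_comm]; exact Submodule.smul_mem _ c hp

lemma wordBracketSpan_mul_mem {j : ℕ} {l : List X} (w : List X) {p : R}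
    (hp : p ∈ wordBracketSpan f j l) : p * (w.map f).prod ∈ wordBracketSpan f j (l ++ w) := by
  induction hp using Submodule.span_induction with
  | mem p hp =>
    obtain ⟨u, a, b, v, h1, h2, rfl⟩ := hp
    refine Submodule.subset_span ⟨u, a, b, v ++ w, h1, ?_, ?_⟩
    · simpa using h2.append_right w
    · simp [mul_assoc]
  | zero => simp
  | add p q _ _ hp hq => rw [add_mul]; exact add_mem hp hq
  | smul c p _ hp => rw [smul_mul_assoc]; exact Submodule.smul_mem _ c hp

lemma symBracketSpan_mul_mem {j : ℕ} {l : List X} (w : List X) {p : R}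
    (hp : p ∈ symBracketSpan f j l) : p * (w.map f).prod ∈ symBracketSpan f j (l ++ w) := by
  induction hp using Submodule.span_induction with
  | mem p hp =>
    obtain ⟨u, a, b, v, h1, h2, rfl⟩ := hp
    refine Submodule.subset_span ⟨u, a, b, v ++ w, h1, ?_, ?_⟩
    · simpa using h2.append_right w
    · simp [mul_assoc]
  | zero => simp
  | add p q _ _ hp hq => rw [add_mul]; exact add_mem hp hq
  | smul c p _ hp => rw [smul_mul_assoc]; exact Submodule.smul_mem _ c hp

/-- A permutation is a chain of adjacent transpositions, and each of them costs one product with a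
bracket in place of two neighbours; at most `l.length - 2` letters precede that bracket. -/
lemma prod_sub_prod_mem {l l' : List X} (h : l.Perm l') :
    (l.map f).prod - (l'.map f).prod ∈ wordBracketSpan f (l.length - 1) l := by
  induction h with
  | nil => simp
  | @cons x l l' h ih =>
    have := mul_mem_wordBracketSpan x ih
    rw [mul_sub] at this
    -- The subtraction in the bound is truncated, so the empty tail is treated apart; for a nonempty
    -- tail `l.length - 1 + 1 = l.length`.
    cases l with
    | nil => simp [List.nil_perm.1 h]
    | cons y l => simpa using this
  | swap x y l =>
    refine Submodule.subset_span ⟨[], y, x, l, by simp, by simp, ?_⟩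
    simp [sub_mul, mul_assoc]
  | @trans l l' l'' h h' ih ih' =>
    rw [← sub_add_sub_cancel _ (l'.map f).prod]
    exact add_mem ih (wordBracketSpan_mono (by rw [h.length_eq]) h.symm ih')

lemma prod_sub_symList_mem (l : List X) :
    (l.map f).prod - symList (l.map f) ∈ wordBracketSpan f (l.length - 1) l :=
  sub_symList_mem _ f _ l fun _ h => prod_sub_prod_mem h.symm

/-- Replacing the prefix `u` by `𝔰(u)` produces an error in which a bracket already occurs inside
`u`, hence with a strictly shorter prefix; induction on the prefix length disposes of it. -/
lemma wordBracketSpan_le_symBracketSpan (j : ℕ) (l : List X) :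
    wordBracketSpan f j l ≤ symBracketSpan f j l := by
  induction j generalizing l with
  | zero => exact Submodule.span_le.2 fun p ⟨u, a, b, v, h, _⟩ => by simp at h
  | succ j ih =>
    refine Submodule.span_le.2 ?_
    rintro _ ⟨u, a, b, v, h1, h2, rfl⟩
    rw [SetLike.mem_coe]
    have h3 := prod_sub_symList_mem (f := f) u
    -- This is `(u - 𝔰(u)) · [a, b] · v`, obtained as the difference of the versions with tails `a b
    -- v` and `b a v`.
    have h4 := sub_mem (wordBracketSpan_mul_mem (a :: b :: v) h3)
      (wordBracketSpan_mono le_rfl ((List.Perm.swap a b v).append_left u)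
        (wordBracketSpan_mul_mem (b :: a :: v) h3))
    have h5 := symBracketSpan_mono (Nat.le_succ j) h2
      (ih _ (wordBracketSpan_mono (show u.length - 1 ≤ j by omega) (List.Perm.refl _) h4))
    have h6 : symList (u.map f) * (f a * f b - f b * f a) * (v.map f).prod ∈
        symBracketSpan f j.succ l := Submodule.subset_span ⟨u, a, b, v, h1, h2, rfl⟩
    convert add_mem h5 h6 using 1
    simp only [List.map_cons, List.prod_cons]
    noncomm_ring

/-- Up to products that begin with shorter blocks, the cyclic sum of `𝔰(u x) · [a, b]` vanishes. -/
lemma cyclic_mem (u : List X) (x a b : X) :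
    symList ((x :: u).map f) * (f a * f b - f b * f a) +
      symList ((a :: u).map f) * (f b * f x - f x * f b) +
      symList ((b :: u).map f) * (f x * f a - f a * f x) ∈
    wordBracketSpan f (u.length + 1) (u ++ [x, a, b]) := by
  have key (x a b : X) : ((u ++ [x]).map f).prod * (f a * f b - f b * f a) -
      symList ((x :: u).map f) * (f a * f b - f b * f a) ∈
        wordBracketSpan f (u.length + 1) (u ++ [x, a, b]) := by
    have h3 := prod_sub_symList_mem (f := f) (u ++ [x])
    have h4 := sub_mem (wordBracketSpan_mul_mem [a, b] h3)
      (wordBracketSpan_mono le_rfl ((List.Perm.swap a b []).append_left (u ++ [x]))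
        (wordBracketSpan_mul_mem [b, a] h3))
    have h5 : symList ((u ++ [x]).map f) = symList ((x :: u).map f) :=
      symList_perm ((List.perm_append_singleton x u).map f)
    rw [h5] at h4
    have h6 := wordBracketSpan_mono (k := u.length + 1) (by simp)
      (show (u ++ [x] ++ [a, b]).Perm (u ++ [x, a, b]) by simp) h4
    convert h6 using 1
    simp only [List.map_cons, List.prod_cons, List.map_nil, List.prod_nil]
    noncomm_ring
  have key2 (x a b : X) : (u.map f).prod * (f a * f b - f b * f a) * f x ∈
      wordBracketSpan f (u.length + 1) (u ++ [a, b, x]) :=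
    Submodule.subset_span ⟨u, a, b, [x], by simp, by simp, by simp⟩
  have p1 : (u ++ [a, b, x]).Perm (u ++ [x, a, b]) :=
    List.Perm.append_left u (by simpa using (List.perm_append_comm (l₁ := [a, b]) (l₂ := [x])))
  have p2 : (u ++ [b, x, a]).Perm (u ++ [x, a, b]) :=
    List.Perm.append_left u (by simpa using (List.perm_append_comm (l₁ := [b]) (l₂ := [x, a])))
  have m1 := sub_mem (wordBracketSpan_mono le_rfl p1 (key2 x a b)) (key x a b)
  have m2 := sub_mem (key2 b x a) (wordBracketSpan_mono le_rfl p1 (key a b x))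
  have m3 := sub_mem (wordBracketSpan_mono le_rfl p2 (key2 a b x))
    (wordBracketSpan_mono le_rfl p2 (key b x a))
  -- Modulo the span, `𝔰(x u) · [a, b]` is `u · x · [a, b]`, and `u · [a, b] · x` is zero. The
  -- cyclic sum of the differences `[a, b] · x - x · [a, b]` vanishes by the Jacobi identity.
  convert add_mem (add_mem m1 m2) m3 using 1
  simp only [List.map_append, List.prod_append, List.map_cons, List.prod_cons, List.map_nil,
    List.prod_nil]
  noncomm_ring

variable [LinearOrder X]

/-- The order condition on a block `𝔰(u) · [a, b]`. -/
def IsBlock (u : List X) (a b : X) : Prop := u.Pairwise (fun x y => y ≤ x) ∧ b < a ∧ ∀ x ∈ u, b ≤ x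

variable (f) in
/-- The span of the products `𝔰(u) · [a, b] · v` with fewer than `j` letters in `u` that begin
with an ordered block. -/
def blockSpan (j : ℕ) (l : List X) : Submodule ℝ R :=
  Submodule.span ℝ {p | ∃ u a b v, IsBlock u a b ∧ u.length < j ∧ (u ++ a :: b :: v).Perm l ∧
    symList (u.map f) * (f a * f b - f b * f a) * (v.map f).prod = p}

lemma blockSpan_mono {j k : ℕ} (h : j ≤ k) {l l' : List X} (hl : l.Perm l') :
    blockSpan f j l ≤ blockSpan f k l' :=
  Submodule.span_mono fun _ ⟨u, a, b, v, h0, h1, h2, h3⟩ =>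
    ⟨u, a, b, v, h0, h1.trans_le h, h2.trans hl, h3⟩

variable (f) in
/-- The span of the ordered blocks `𝔰(u) · [a, b]` with `n` letters in `u`. -/
def exactBlockSpan (n : ℕ) (l : List X) : Submodule ℝ R :=
  Submodule.span ℝ {p | ∃ u a b, IsBlock u a b ∧ u.length = n ∧ (u ++ [a, b]).Perm l ∧
    symList (u.map f) * (f a * f b - f b * f a) = p}

lemma mem_exactBlockSpan {l : List X} (u : List X) (a b : X) (hab : b < a) (hu : ∀ x ∈ u, b ≤ x)
    (hl : (u ++ [a, b]).Perm l) :
    symList (u.map f) * (f a * f b - f b * f a) ∈ exactBlockSpan f u.length l := by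
  have hp := List.perm_insertionSort (fun x y : X => y ≤ x) u
  refine Submodule.subset_span ⟨u.insertionSort (fun x y => y ≤ x), a, b,
    ⟨List.pairwise_insertionSort _ u, hab, fun x hx => hu x (hp.mem_iff.1 hx)⟩, hp.length_eq,
    (hp.append_right _).trans hl, ?_⟩
  rw [symList_perm (hp.map f)]

/-- If the smallest letter `x` is strictly below both bracket letters, the cyclic relation trades
`𝔰(x t) · [a, b]` for `𝔰(b t) · [a, x] - 𝔰(a t) · [b, x]`, where `x` sits in the lower slot and the
order conditions hold after sorting. The number of letters in the symmetric part is unchanged in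
these main terms, while all errors have fewer; the triangularity argument needs this distinction. -/
theorem straighten (u : List X) (a b : X) :
    symList (u.map f) * (f a * f b - f b * f a) ∈
      exactBlockSpan f u.length (u ++ [a, b]) ⊔ symBracketSpan f u.length (u ++ [a, b]) := by
  -- Exchanging `a` and `b` changes the sign of the bracket and keeps the multiset of letters.
  wlog hab : b ≤ a generalizing a b
  · have h := neg_mem (this b a (le_of_not_ge hab))
    have e : exactBlockSpan f u.length (u ++ [b, a]) = exactBlockSpan f u.length (u ++ [a, b]) := by
      have (l : List X) : l.Perm (u ++ [b, a]) ↔ l.Perm (u ++ [a, b]) :=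
        ((List.Perm.swap a b []).append_left u).congr_right l
      simp only [exactBlockSpan, this]
    rw [e] at h
    have h' := sup_le_sup_left (symBracketSpan_mono (f := f) (le_refl u.length)
      ((List.Perm.swap a b []).append_left u)) _ h
    convert h' using 1
    noncomm_ring
  rcases hab.eq_or_lt with rfl | hab
  · simp
  by_cases hu : ∀ x ∈ u, b ≤ x
  · exact Submodule.mem_sup_left (mem_exactBlockSpan u a b hab hu (List.Perm.refl _))
  push Not at hu
  obtain ⟨y, hy, hyb⟩ := hu
  obtain ⟨x, hx, hmin⟩ : ∃ x ∈ u, ∀ y ∈ u, x ≤ y := by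
    obtain ⟨x, hx, h⟩ := u.toFinset.exists_min_image id ⟨y, by simpa using hy⟩
    exact ⟨x, by simpa using hx, fun y hy => h y (by simpa using hy)⟩
  have hxb : x < b := (hmin y hy).trans_lt hyb
  have hperm := List.perm_cons_erase hx
  set t := u.erase x with ht
  have hlen : u.length = t.length + 1 := by simpa using hperm.length_eq
  have hsub : ∀ y ∈ t, x ≤ y := fun y hy => hmin y (List.mem_of_mem_erase hy)
  rw [symList_perm (hperm.map f)]
  -- The cyclic relation for `x`, `a`, `b`, with its error rewritten so that every prefix is
  -- symmetrized.
  have hc := symBracketSpan_mono le_rfl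
    (show (t ++ [x, a, b]).Perm (u ++ [a, b]) from
      (by simp :
        (t ++ [x, a, b]).Perm (x :: t ++ [a, b])).trans (hperm.symm.append_right _))
    (wordBracketSpan_le_symBracketSpan _ _ (cyclic_mem (f := f) t x a b))
  have h1 := mem_exactBlockSpan (f := f) (l := u ++ [a, b]) (a :: t) b x hxb
    (by simpa using ⟨(hxb.trans hab).le, hsub⟩) (by
      refine List.Perm.trans ?_ (hperm.symm.append_right _)
      rw [List.perm_iff_count]; intro c; simp [List.count_cons, List.count_append]; omega)
  have h2 := mem_exactBlockSpan (f := f) (l := u ++ [a, b]) (b :: t) a x (hxb.trans hab)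
    (by simpa using ⟨hxb.le, hsub⟩) (by
      refine List.Perm.trans ?_ (hperm.symm.append_right _)
      rw [List.perm_iff_count]; intro c; simp [List.count_cons, List.count_append]; omega)
  rw [← hlen] at hc
  rw [List.length_cons, ← hlen] at h1 h2
  have := add_mem (Submodule.mem_sup_left (T := symBracketSpan f u.length (u ++ [a, b]))
    (sub_mem h2 h1)) (Submodule.mem_sup_right hc)
  convert this using 1
  noncomm_ring

/-- Straightening the first block leaves ordered blocks of the same size and errors with shorter
symmetric parts, which are covered by induction on the bound. The tail after the first block stays
an arbitrary word. -/
lemma symBracketSpan_le_blockSpan (j : ℕ) (l : List X) :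
    symBracketSpan f j l ≤ blockSpan f j l := by
  induction j generalizing l with
  | zero => exact Submodule.span_le.2 fun p ⟨u, a, b, v, h, _⟩ => by simp at h
  | succ j ih =>
    refine Submodule.span_le.2 ?_
    rintro _ ⟨u, a, b, v, h1, h2, rfl⟩
    obtain ⟨p, hp, q, hq, hpq⟩ := Submodule.mem_sup.1 (straighten (f := f) u a b)
    rw [← hpq, add_mul]
    refine add_mem ?_ ?_
    · clear hpq
      induction hp using Submodule.span_induction with
      | mem p hp =>
        obtain ⟨u', a', b', h3, h4, h5, rfl⟩ := hp
        refine Submodule.subset_span ⟨u', a', b', v, h3, by omega, ?_, rfl⟩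
        exact (by simpa using h5.append_right v : (u' ++ a' :: b' :: v).Perm
          (u ++ a :: b :: v)).trans h2
      | zero => simp
      | add p q _ _ hp hq => rw [add_mul]; exact add_mem hp hq
      | smul c p _ hp => rw [smul_mul_assoc]; exact Submodule.smul_mem _ c hp
    · exact blockSpan_mono (Nat.le_succ j) (by simpa using h2)
        (ih _ (symBracketSpan_mono (by omega) (List.Perm.refl _) (symBracketSpan_mul_mem v hq)))

end Straighten

end

/-! ### Contents and gradings -/

-- Multilinear maps and lower terms

section Span

variable {M N P : Type*} [AddCommGroup M] [AddCommGroup N] [AddCommGroup P] [Module ℝ M]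
  [Module ℝ N] [Module ℝ P]

lemma map_mem_of_mem_span (L : M →ₗ[ℝ] P) {S : Set M} {Q : Submodule ℝ P} (h : ∀ s ∈ S, L s ∈ Q)
    {a : M} (ha : a ∈ Submodule.span ℝ S) : L a ∈ Q :=
  (Submodule.span_le (p := Q.comap L)).2 h ha

lemma map₂_mem_of_mem_span (B : M →ₗ[ℝ] N →ₗ[ℝ] P) {S : Set M} {T : Set N} {Q : Submodule ℝ P}
    (h : ∀ s ∈ S, ∀ t ∈ T, B s t ∈ Q) {a : M} {b : N} (ha : a ∈ Submodule.span ℝ S)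
    (hb : b ∈ Submodule.span ℝ T) : B a b ∈ Q :=
  map_mem_of_mem_span (B.flip b) (fun s hs => map_mem_of_mem_span (B s) (h s hs) hb) ha

/-- The difference of two values of a bilinear map, when the arguments differ by lower terms. -/
lemma map₂_sub_mem_span (B : M →ₗ[ℝ] N →ₗ[ℝ] P) {ι κ : Type*} {f : ι → M} {g : κ → N} {I : Set ι}
    {J : Set κ} {i : ι} {j : κ} (hi : i ∈ I) (hj : j ∈ J) {a : M} {b : N}
    (ha : a - f i ∈ Submodule.span ℝ (f '' (I \ {i})))
    (hb : b - g j ∈ Submodule.span ℝ (g '' (J \ {j}))) :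
    B a b - B (f i) (g j) ∈ Submodule.span ℝ
      ((fun p : ι × κ => B (f p.1) (g p.2)) '' ((I ×ˢ J) \ {(i, j)})) := by
  have h : B a b - B (f i) (g j) =
      B (a - f i) (b - g j) + B (a - f i) (g j) + B (f i) (b - g j) := by
    simp only [map_sub, LinearMap.sub_apply]; abel
  rw [h]
  refine add_mem (add_mem ?_ ?_) ?_
  · refine map₂_mem_of_mem_span B ?_ ha hb
    rintro _ ⟨i', hi', rfl⟩ _ ⟨j', hj', rfl⟩
    exact Submodule.subset_span ⟨(i', j'),
      ⟨⟨hi'.1, hj'.1⟩, fun h => hi'.2 (Prod.ext_iff.1 h).1⟩, rfl⟩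
  · refine map_mem_of_mem_span (B.flip (g j)) ?_ ha
    rintro _ ⟨i', hi', rfl⟩
    exact Submodule.subset_span ⟨(i', j), ⟨⟨hi'.1, hj⟩, fun h => hi'.2 (Prod.ext_iff.1 h).1⟩, rfl⟩
  · refine map_mem_of_mem_span (B (f i)) ?_ hb
    rintro _ ⟨j', hj', rfl⟩
    exact Submodule.subset_span ⟨(i, j'), ⟨⟨hi, hj'.1⟩, fun h => hj'.2 (Prod.ext_iff.1 h).2⟩, rfl⟩

lemma multilinear_mem_span {ι : Type*} [Fintype ι] [DecidableEq ι]
    (g : MultilinearMap ℝ (fun _ : ι => M) P) {κ : Type*} (f : κ → M) (I : ι → Set κ) {a : ι → M}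
    (ha : ∀ i, a i ∈ Submodule.span ℝ (f '' I i)) :
    g a ∈ Submodule.span ℝ ((fun k : ι → κ => g fun i => f (k i)) '' {k | ∀ i, k i ∈ I i}) := by
  have key (s : Finset ι) : ∀ a : ι → M, (∀ i ∈ s, a i ∈ Submodule.span ℝ (f '' I i)) →
      (∀ i ∉ s, a i ∈ f '' I i) → g a ∈ Submodule.span ℝ
        ((fun k : ι → κ => g fun i => f (k i)) '' {k | ∀ i, k i ∈ I i}) := by
    induction s using Finset.induction_on with
    | empty =>
      intro a _ h
      choose k hk hk' using fun i => h i (by simp)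
      exact Submodule.subset_span ⟨k, hk, by simp only [hk']⟩
    | insert j s hj ih =>
      intro a h1 h2
      have h3 := map_mem_of_mem_span (g.toLinearMap a j) (Q := Submodule.span ℝ
        ((fun k : ι → κ => g fun i => f (k i)) '' {k | ∀ i, k i ∈ I i})) (fun m hm => ?_)
        (h1 j (Finset.mem_insert_self j s))
      · simpa using h3
      · refine ih _ (fun i hi => ?_) fun i hi => ?_
        · rw [Function.update_of_ne (by rintro rfl; exact hj hi)]
          exact h1 i (Finset.mem_insert_of_mem hi)
        · by_cases hij : i = j
          · subst hij; simpa using hm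
          · rw [Function.update_of_ne hij]
            exact h2 i (by simp [hi, hij])
  exact key Finset.univ a (fun i _ => ha i) (by simp)

/-- The difference of two values of a multilinear map, when the arguments differ by lower terms. -/
lemma multilinear_sub_mem_span {ι : Type*} [Fintype ι] [DecidableEq ι]
    (g : MultilinearMap ℝ (fun _ : ι => M) P) {κ : Type*} (f : κ → M) (I : ι → Set κ) {a : ι → M}
    {k₀ : ι → κ} (hk₀ : ∀ i, k₀ i ∈ I i)
    (ha : ∀ i, a i - f (k₀ i) ∈ Submodule.span ℝ (f '' (I i \ {k₀ i}))) :
    g a - g (fun i => f (k₀ i)) ∈ Submodule.span ℝ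
      ((fun k : ι → κ => g fun i => f (k i)) '' ({k | ∀ i, k i ∈ I i} \ {k₀})) := by
  have key (s : Finset ι) : ∀ a : ι → M,
      (∀ i, a i - f (k₀ i) ∈ Submodule.span ℝ (f '' (I i \ {k₀ i}))) →
      (∀ i ∉ s, a i = f (k₀ i)) → g a - g (fun i => f (k₀ i)) ∈ Submodule.span ℝ
        ((fun k : ι → κ => g fun i => f (k i)) '' ({k | ∀ i, k i ∈ I i} \ {k₀})) := by
    induction s using Finset.induction_on with
    | empty =>
      intro a _ h
      rw [show a = fun i => f (k₀ i) from funext fun i => h i (by simp), sub_self]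
      exact Submodule.zero_mem _
    | insert j s hj ih =>
      intro a h1 h2
      have h3 : g a = g (Function.update a j (a j - f (k₀ j))) +
          g (Function.update a j (f (k₀ j))) := by
        rw [← g.map_update_add, sub_add_cancel, Function.update_eq_self]
      rw [h3, add_sub_assoc]
      refine add_mem ?_ (ih _ (fun i => ?_) fun i hi => ?_)
      -- In this summand the `j`-th index avoids `k₀ j`, so no tuple that occurs can equal `k₀`,
      -- whatever the other indices are.
      · have h4 := multilinear_mem_span g f (fun i => if i = j then I i \ {k₀ i} else I i)
          (a := Function.update a j (a j - f (k₀ j))) (fun i => by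
            by_cases hij : i = j
            · subst hij; simpa using h1 i
            · rw [Function.update_of_ne hij, if_neg hij, ← sub_add_cancel (a i) (f (k₀ i))]
              exact add_mem (Submodule.span_mono (Set.image_mono Set.sdiff_subset) (h1 i))
                (Submodule.subset_span (Set.mem_image_of_mem f (hk₀ i))))
        refine Submodule.span_mono (Set.image_mono ?_) h4
        intro k hk
        refine ⟨fun i => ?_, ?_⟩
        · have := hk i
          split_ifs at this
          exacts [this.1, this]
        · rintro rfl
          have := hk j
          simp at this
      · by_cases hij : i = j
        · subst hij; simp
        · rw [Function.update_of_ne hij]; exact h1 i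
      · by_cases hij : i = j
        · subst hij; simp
        · rw [Function.update_of_ne hij]; exact h2 i (by simp [hi, hij])
  exact key Finset.univ a ha (by simp)

end Span

-- Content and word length on `A` and on the tensor algebra

noncomputable section

variable {C : Type u}

/-- The multiset of the generators of a monomial. -/
def Mon.content : Mon C → Multiset C
  | .gen c => {c}
  | .brk s t => s.content + t.content
  | .tri s t => s.content + t.content

lemma Mon.card_content (m : Mon C) : m.content.card = m.vert := by
  induction m with
  | gen c => simp [content, vert]
  | brk s t hs ht => simp [content, vert, hs, ht]
  | tri s t hs ht => simp [content, vert, hs, ht]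

lemma Mon.vert_pos (m : Mon C) : 0 < m.vert := by
  induction m with
  | gen c => simp [vert]
  | brk s t hs ht => simp [vert, hs]
  | tri s t hs ht => simp [vert, hs]

/-- The span of the monomials with a given content. -/
def homA (μ : Multiset C) : Submodule ℝ (A C) :=
  Submodule.span ℝ {a | ∃ m : Mon C, m.content = μ ∧ Finsupp.single m 1 = a}

/-- The span of the words with `k` letters and a given content. -/
def homD (μ : Multiset C) (k : ℕ) : Submodule ℝ (D C) :=
  Submodule.span ℝ {p | ∃ w : List (Mon C), (w.map Mon.content).sum = μ ∧ w.length = k ∧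
    word w = p}

/-- The span of the words with fewer than `k` letters and a given content. -/
def lowD (μ : Multiset C) (k : ℕ) : Submodule ℝ (D C) :=
  Submodule.span ℝ {p | ∃ w : List (Mon C), (w.map Mon.content).sum = μ ∧ w.length < k ∧
    word w = p}

lemma single_mem_homA (m : Mon C) : Finsupp.single m 1 ∈ homA m.content :=
  Submodule.subset_span ⟨m, rfl, rfl⟩

lemma word_mem_homD (w : List (Mon C)) : word w ∈ homD (w.map Mon.content).sum w.length :=
  Submodule.subset_span ⟨w, rfl, rfl, rfl⟩

lemma homD_le_lowD {μ : Multiset C} {j k : ℕ} (h : j < k) : homD μ j ≤ lowD μ k :=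
  Submodule.span_mono fun _ ⟨w, h1, h2, h3⟩ => ⟨w, h1, h2.trans_lt h, h3⟩

lemma lowD_mono {μ : Multiset C} {j k : ℕ} (h : j ≤ k) : lowD μ j ≤ lowD μ k :=
  Submodule.span_mono fun _ ⟨w, h1, h2, h3⟩ => ⟨w, h1, h2.trans_le h, h3⟩

lemma span_eq_top {S : Set (A C)} (h : ∀ m : Mon C, Finsupp.single m 1 ∈ Submodule.span ℝ S) :
    Submodule.span ℝ S = ⊤ :=
  eq_top_iff.2 fun a _ => by
    induction a using mon_induction with
    | zero => exact Submodule.zero_mem _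
    | add p q hp hq => exact add_mem (hp trivial) (hq trivial)
    | smul c p hp => exact Submodule.smul_mem _ c (hp trivial)
    | h s => exact h s

lemma homA_le_graded {μ : Multiset C} {i : ℕ} (h : μ.card = i) : homA μ ≤ graded C i := by
  refine Submodule.span_le.2 ?_
  rintro _ ⟨m, rfl, rfl⟩
  exact Finsupp.single_mem_supported ℝ 1 (show m.vert = i by rw [← m.card_content, h])

lemma gen_mem_homA (c : C) : gen c ∈ homA {c} := single_mem_homA (.gen c)

lemma brk_mem_homA {μ ν : Multiset C} {a b : A C} (ha : a ∈ homA μ) (hb : b ∈ homA ν) :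
    brk a b ∈ homA (μ + ν) := by
  refine map₂_mem_of_mem_span brk ?_ ha hb
  rintro _ ⟨s, rfl, rfl⟩ _ ⟨t, rfl, rfl⟩
  rw [brk_single]
  exact single_mem_homA (.brk s t)

lemma tri_mem_homA {μ ν : Multiset C} {a b : A C} (ha : a ∈ homA μ) (hb : b ∈ homA ν) :
    tri a b ∈ homA (μ + ν) := by
  refine map₂_mem_of_mem_span tri ?_ ha hb
  rintro _ ⟨s, rfl, rfl⟩ _ ⟨t, rfl, rfl⟩
  rw [tri_single]
  exact single_mem_homA (.tri s t)

lemma mul_mem_homD {μ ν : Multiset C} {j k : ℕ} {p q : D C} (hp : p ∈ homD μ j)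
    (hq : q ∈ homD ν k) : p * q ∈ homD (μ + ν) (j + k) := by
  refine map₂_mem_of_mem_span (LinearMap.mul ℝ (D C)) ?_ hp hq
  rintro _ ⟨s, rfl, rfl, rfl⟩ _ ⟨t, rfl, rfl, rfl⟩
  exact Submodule.subset_span ⟨s ++ t, by simp, by simp, word_append s t⟩

lemma one_mem_homD : (1 : D C) ∈ homD 0 0 :=
  Submodule.subset_span ⟨[], by simp, by simp, by simp [word]⟩

lemma inc_mem_homD {μ : Multiset C} {a : A C} (ha : a ∈ homA μ) : inc a ∈ homD μ 1 := by
  refine map_mem_of_mem_span inc ?_ ha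
  rintro _ ⟨s, rfl, rfl⟩
  exact Submodule.subset_span ⟨[s], by simp, by simp, by simp [word]⟩

lemma inc_mul_mem_lowD {μ ν : Multiset C} {k : ℕ} {a : A C} {p : D C} (ha : a ∈ homA μ)
    (hp : p ∈ lowD ν k) : inc a * p ∈ lowD (μ + ν) (k + 1) := by
  refine map_mem_of_mem_span (LinearMap.mulLeft ℝ (inc a)) ?_ hp
  rintro _ ⟨w, rfl, h, rfl⟩
  exact homD_le_lowD (by omega) (mul_mem_homD (inc_mem_homD ha) (word_mem_homD w))

lemma list_prod_mem_homD {X : Type*} {f : X → D C} {c : X → Multiset C}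
    (l : List X) (h : ∀ x ∈ l, f x ∈ homD (c x) 1) :
    (l.map f).prod ∈ homD (l.map c).sum l.length := by
  induction l with
  | nil => exact one_mem_homD
  | cons x l ih =>
    rw [List.length_cons, add_comm]
    simpa using mul_mem_homD (h x List.mem_cons_self)
      (ih fun x hx => h x (List.mem_cons_of_mem _ hx))

lemma symList_mem_homD {X : Type*} {f : X → D C} {c : X → Multiset C}
    (l : List X) (h : ∀ x ∈ l, f x ∈ homD (c x) 1) :
    symList (l.map f) ∈ homD (l.map c).sum l.length := by
  have := sub_symList_mem (homD (l.map c).sum l.length) f 0 l (fun l' hl => by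
    rw [zero_sub, neg_mem_iff, ← hl.length_eq, ← (hl.map c).sum_eq]
    exact list_prod_mem_homD l' fun x hx => h x (hl.mem_iff.1 hx))
  rwa [zero_sub, neg_mem_iff] at this

lemma comm_mem_homD {μ ν : Multiset C} {a b : A C} (ha : a ∈ homA μ) (hb : b ∈ homA ν) :
    comm a b ∈ homD (μ + ν) 2 := by
  have h1 := mul_mem_homD (inc_mem_homD ha) (inc_mem_homD hb)
  have h2 := mul_mem_homD (inc_mem_homD hb) (inc_mem_homD ha)
  rw [add_comm ν] at h2
  exact Submodule.sub_mem _ h1 h2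

lemma content_of_mem_graftAt {s : Mon C} {l l' : List (Mon C)} (h : l' ∈ graftAt s l) :
    (l'.map Mon.content).sum = s.content + (l.map Mon.content).sum := by
  induction l generalizing l' with
  | nil => simp [graftAt] at h
  | cons t l ih =>
    simp only [graftAt, List.mem_cons, List.mem_map] at h
    rcases h with rfl | ⟨m, hm, rfl⟩
    · simp [Mon.content, add_assoc]
    · simp [ih hm, add_left_comm]

lemma der_mem_homD {μ ν : Multiset C} {k : ℕ} {a : A C} {p : D C} (ha : a ∈ homA μ)
    (hp : p ∈ homD ν k) : der a p ∈ homD (μ + ν) k := by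
  refine map₂_mem_of_mem_span der ?_ ha hp
  rintro _ ⟨s, rfl, rfl⟩ _ ⟨w, rfl, rfl, rfl⟩
  rw [der_single_word]
  refine list_sum_mem fun p hp => ?_
  obtain ⟨w', h, rfl⟩ := List.mem_map.1 hp
  exact Submodule.subset_span ⟨w', content_of_mem_graftAt h, length_of_mem_graftAt h, rfl⟩

lemma der_mem_lowD {μ ν : Multiset C} {k : ℕ} {a : A C} {p : D C} (ha : a ∈ homA μ)
    (hp : p ∈ lowD ν k) : der a p ∈ lowD (μ + ν) k := by
  refine map_mem_of_mem_span (der a) ?_ hp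
  rintro _ ⟨w, rfl, h, rfl⟩
  exact homD_le_lowD h (der_mem_homD ha (word_mem_homD w))

lemma act_one (a : A C) : act 1 a = a := extend_one tri a

lemma act_inc_mul (x : A C) (p : D C) (a : A C) :
    act (inc x * p) a = tri x (act p a) - act (der x p) a := extend_inc_mul tri x p a

lemma act_mem_homA {μ ν : Multiset C} {k : ℕ} {p : D C} {a : A C} (hp : p ∈ homD μ k)
    (ha : a ∈ homA ν) : act p a ∈ homA (μ + ν) := by
  induction k generalizing μ p with
  | zero =>
    refine map_mem_of_mem_span (act.flip a) ?_ hp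
    rintro _ ⟨w, rfl, h, rfl⟩
    rw [List.length_eq_zero_iff] at h
    subst h
    simpa [word, act_one] using ha
  | succ k ih =>
    refine map_mem_of_mem_span (act.flip a) ?_ hp
    rintro _ ⟨w, rfl, h, rfl⟩
    obtain ⟨s, w, rfl⟩ := List.exists_cons_of_length_eq_add_one h
    obtain rfl : w.length = k := by simpa using h
    simp only [LinearMap.flip_apply, word_cons, act_inc_mul, List.map_cons, List.sum_cons]
    refine sub_mem ?_ (ih (der_mem_homD (single_mem_homA s) (word_mem_homD w)))
    rw [add_assoc]
    exact tri_mem_homA (single_mem_homA s) (ih (word_mem_homD w))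

/-- By induction on the word: the recursion for `(s · w) ▷ _` produces only terms in which `s`
multiplies a shorter word or is grafted onto letters. Grafting with `der` keeps the number of
letters, so the letter `s` is lost from the count. The correction `e` does not depend on the
argument `a`. -/
lemma act_word_comp_sub_mem {ν : Multiset C} {k : ℕ} {q : D C} (hq : q ∈ homD ν k)
    (n : ℕ) (w : List (Mon C)) (hn : w.length = n) :
    ∃ e ∈ lowD ((w.map Mon.content).sum + ν) (n + k),
      ∀ a, act (word w) (act q a) = act (word w * q) a + act e a := by
  induction n generalizing w with
  | zero =>
    rw [List.length_eq_zero_iff] at hn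
    subst hn
    exact ⟨0, Submodule.zero_mem _, fun a => by simp [word, act_one]⟩
  | succ n ih =>
    obtain ⟨s, w, rfl⟩ := List.exists_cons_of_length_eq_add_one hn
    have hn' : w.length = n := by simpa using hn
    obtain ⟨e, he, h1⟩ := ih w hn'
    obtain ⟨e', he', h2⟩ : ∃ e ∈ lowD (s.content + (w.map Mon.content).sum + ν) (n + k),
        ∀ a, act (der (Finsupp.single s 1) (word w)) (act q a) =
          act (der (Finsupp.single s 1) (word w) * q) a + act e a := by
      rw [der_single_word]
      have h (L : List (List (Mon C))) (hL : ∀ m ∈ L, m ∈ graftAt s w) :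
          ∃ e ∈ lowD (s.content + (w.map Mon.content).sum + ν) (n + k),
            ∀ a, act (L.map word).sum (act q a) = act ((L.map word).sum * q) a + act e a := by
        induction L with
        | nil => exact ⟨0, Submodule.zero_mem _, fun a => by simp⟩
        | cons m L ihL =>
          obtain ⟨e₁, he₁, h₁⟩ := ihL fun m' hm' => hL m' (List.mem_cons_of_mem _ hm')
          have hm := hL m List.mem_cons_self
          obtain ⟨e₂, he₂, h₂⟩ := ih m (by rw [length_of_mem_graftAt hm, hn'])
          rw [content_of_mem_graftAt hm] at he₂
          refine ⟨e₂ + e₁, add_mem he₂ he₁, fun a => ?_⟩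
          simp only [List.map_cons, List.sum_cons, add_mul, map_add, LinearMap.add_apply, h₁, h₂]
          abel
      exact h _ fun m hm => hm
    have hs := single_mem_homA s
    -- The correction collects `w · (s ▷ q)` from the Leibniz rule, `s · e + s ▷ e` from `s ▷ (e ▷
    -- a)`, and `-e'` from the words in `s ▷ w`.
    refine ⟨word w * der (Finsupp.single s 1) q + inc (Finsupp.single s 1) * e +
      der (Finsupp.single s 1) e - e', ?_, fun a => ?_⟩
    · rw [List.map_cons, List.sum_cons]
      refine sub_mem (add_mem (add_mem ?_ ?_) ?_) ?_
      · have := mul_mem_homD (word_mem_homD w) (der_mem_homD hs hq)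
        rw [← add_assoc, add_comm _ s.content, hn'] at this
        exact homD_le_lowD (by omega) this
      · have := inc_mul_mem_lowD hs he
        rw [← add_assoc] at this
        exact lowD_mono (by omega) this
      · have := der_mem_lowD hs he
        rw [← add_assoc] at this
        exact lowD_mono (by omega) this
      · exact lowD_mono (by omega) he'
    · rw [word_cons, act_inc_mul, h1, h2, mul_assoc, act_inc_mul, map_add, der_mul]
      simp only [map_add, map_sub, LinearMap.add_apply, LinearMap.sub_apply, act_inc_mul]
      abel

/-- The composition `p ▷ (q ▷ _)` is `(p · q) ▷ _` up to shorter words. -/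
lemma exists_act_act_eq {μ ν : Multiset C} {j k : ℕ} {p q : D C} (hp : p ∈ homD μ j)
    (hq : q ∈ homD ν k) :
    ∃ e ∈ lowD (μ + ν) (j + k), ∀ a, act p (act q a) = act (p * q) a + act e a := by
  induction hp using Submodule.span_induction with
  | mem p hp =>
    obtain ⟨w, rfl, rfl, rfl⟩ := hp
    exact act_word_comp_sub_mem hq _ w rfl
  | zero => exact ⟨0, Submodule.zero_mem _, fun a => by simp⟩
  | add p p' _ _ h h' =>
    obtain ⟨e, he, h⟩ := h
    obtain ⟨e', he', h'⟩ := h'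
    refine ⟨e + e', add_mem he he', fun a => ?_⟩
    simp only [add_mul, map_add, LinearMap.add_apply, h, h']
    abel
  | smul c p _ h =>
    obtain ⟨e, he, h⟩ := h
    exact ⟨c • e, Submodule.smul_mem _ c he, fun a => by simp [h]⟩

end

/-! ### Formal expressions -/

section

variable {C : Type u}

mutual

/-- The multiset of the generators of an expression. -/
def Expr.content : Expr C → Multiset C
  | .mk ω r => ω.content + r.content

/-- The multiset of the generators of a root. -/
def Root.content : Root C → Multiset C
  | .gen c => {c}
  | .brk u v => u.content + v.content

/-- The multiset of the generators of a block word. -/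
def Osbb.content : Osbb C → Multiset C
  | .sym xs => xs.content
  | .block xs y z ω => xs.content + y.content + z.content + ω.content

/-- The multiset of the generators of the members of a list. -/
def Exprs.content : Exprs C → Multiset C
  | .nil => 0
  | .cons x xs => x.content + xs.content

end

mutual

lemma Expr.card_content (x : Expr C) : x.content.card = x.vert := by
  obtain ⟨ω, r⟩ := x
  simp [Expr.content, Expr.vert, ω.card_content, r.card_content]

lemma Root.card_content (r : Root C) : r.content.card = r.vert := by
  cases r with
  | gen c => simp [Root.content, Root.vert]
  | brk u v => simp [Root.content, Root.vert, u.card_content, v.card_content]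

lemma Osbb.card_content (ω : Osbb C) : ω.content.card = ω.vert := by
  cases ω with
  | sym xs => simp [Osbb.content, Osbb.vert, xs.card_content]
  | block xs y z ω =>
    simp [Osbb.content, Osbb.vert, xs.card_content, y.card_content, z.card_content,
      ω.card_content]

lemma Exprs.card_content (xs : Exprs C) : xs.content.card = xs.vert := by
  cases xs with
  | nil => simp [Exprs.content, Exprs.vert]
  | cons x xs => simp [Exprs.content, Exprs.vert, x.card_content, xs.card_content]

end

mutual

lemma Expr.vert_pos (x : Expr C) : 0 < x.vert := by
  obtain ⟨ω, r⟩ := x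
  have := r.vert_pos
  simp only [Expr.vert]
  omega

lemma Root.vert_pos (r : Root C) : 0 < r.vert := by
  cases r with
  | gen c => simp [Root.vert]
  | brk u v =>
    have := u.vert_pos
    simp only [Root.vert]
    omega

end

/-- The list of expressions with a given underlying list. -/
def Exprs.ofList : List (Expr C) → Exprs C
  | [] => .nil
  | x :: l => .cons x (Exprs.ofList l)

@[simp]
lemma Exprs.toList_ofList (l : List (Expr C)) : (Exprs.ofList l).toList = l := by
  induction l with
  | nil => rfl
  | cons x l ih => simp [ofList, toList, ih]

@[simp]
lemma Exprs.ofList_toList : (xs : Exprs C) → Exprs.ofList xs.toList = xs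
  | .nil => rfl
  | .cons x xs => by simp [ofList, toList, xs.ofList_toList]

lemma Exprs.toList_injective : Function.Injective (Exprs.toList : Exprs C → List (Expr C)) :=
  Function.LeftInverse.injective Exprs.ofList_toList

lemma Exprs.length_toList : (xs : Exprs C) → xs.toList.length = xs.length
  | .nil => rfl
  | .cons x xs => by simp [toList, length, xs.length_toList]

lemma Exprs.content_eq : (xs : Exprs C) → xs.content = (xs.toList.map Expr.content).sum
  | .nil => by simp [content, toList]
  | .cons x xs => by simp [content, toList, xs.content_eq]

lemma Exprs.valid_iff [LT C] : (xs : Exprs C) → (xs.Valid ↔ ∀ x ∈ xs.toList, x.Valid)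
  | .nil => by simp [Valid, toList]
  | .cons x xs => by simp [Valid, toList, xs.valid_iff]

lemma Exprs.eval_eq : (xs : Exprs C) → xs.eval = xs.toList.map Expr.eval
  | .nil => by simp [eval, toList]
  | .cons x xs => by simp [eval, toList, xs.eval_eq]

lemma Exprs.phi_eq : (xs : Exprs C) → xs.phi = xs.toList.map Expr.phi
  | .nil => by simp [phi, toList]
  | .cons x xs => by simp [phi, toList, xs.phi_eq]

/-- The letters of a block word; those of a bracket `[y, z]` are listed in the order `z`, `y`. -/
def Osbb.letters : Osbb C → List (Expr C)
  | .sym xs => xs.toList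
  | .block xs y z ω => xs.toList ++ z :: y :: ω.letters

lemma Osbb.length_letters : (ω : Osbb C) → ω.letters.length = ω.length
  | .sym xs => xs.length_toList
  | .block xs y z ω => by
    simp [letters, length, xs.length_toList, ω.length_letters]; omega

lemma Osbb.content_eq : (ω : Osbb C) → ω.content = (ω.letters.map Expr.content).sum
  | .sym xs => xs.content_eq
  | .block xs y z ω => by
    simp [letters, content, xs.content_eq, ω.content_eq]; abel

end

noncomputable section

variable {C : Type u}

lemma Osbb.eval_sym (xs : Exprs C) :
    (Osbb.sym xs).eval = symList (xs.toList.map fun x => inc x.eval) := by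
  rw [Osbb.eval, symWord_get, xs.eval_eq, List.map_map]
  rfl

lemma Osbb.eval_block (xs : Exprs C) (y z : Expr C) (ω : Osbb C) :
    (Osbb.block xs y z ω).eval =
      symList (xs.toList.map fun x => inc x.eval) * comm y.eval z.eval * ω.eval := by
  rw [Osbb.eval, symWord_get, xs.eval_eq, List.map_map]
  rfl

mutual

lemma Expr.eval_mem (x : Expr C) : x.eval ∈ homA x.content := by
  obtain ⟨ω, r⟩ := x
  rw [Expr.eval, Expr.content]
  exact act_mem_homA ω.eval_mem r.eval_mem

lemma Root.eval_mem (r : Root C) : r.eval ∈ homA r.content := by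
  cases r with
  | gen c => rw [Root.eval, Root.content]; exact gen_mem_homA c
  | brk u v => rw [Root.eval, Root.content]; exact brk_mem_homA u.eval_mem v.eval_mem

lemma Osbb.eval_mem (ω : Osbb C) : ω.eval ∈ homD ω.content ω.length := by
  cases ω with
  | sym xs =>
    rw [Osbb.eval_sym, Osbb.content, Osbb.length, xs.content_eq, ← xs.length_toList]
    exact symList_mem_homD _ fun x hx => inc_mem_homD (xs.eval_mem x hx)
  | block xs y z ω =>
    rw [Osbb.eval_block, Osbb.content, Osbb.length, xs.content_eq, ← xs.length_toList,
      add_assoc _ y.content]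
    exact mul_mem_homD (mul_mem_homD (symList_mem_homD _ fun x hx =>
      inc_mem_homD (xs.eval_mem x hx)) (comm_mem_homD y.eval_mem z.eval_mem)) ω.eval_mem

lemma Exprs.eval_mem (xs : Exprs C) : ∀ x ∈ xs.toList, x.eval ∈ homA x.content := by
  cases xs with
  | nil => simp [Exprs.toList]
  | cons x xs =>
    simp only [Exprs.toList, List.mem_cons, forall_eq_or_imp]
    exact ⟨x.eval_mem, xs.eval_mem⟩

end

/-- The monomial is not a product `s ▷ t`. -/
def Mon.IsRoot : Mon C → Prop
  | .gen _ => True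
  | .brk _ _ => True
  | .tri _ _ => False

/-- Follow the right spine: if `t` is a combination of terms `w ▷ t'`, then `s ▷ (w ▷ t') = (s · w)
▷ t' + (s ▷ w) ▷ t'`, and grafting leaves the root `t'` and the total content untouched. -/
lemma single_mem_span_act (m : Mon C) :
    Finsupp.single m 1 ∈ Submodule.span ℝ {a | ∃ (w : List (Mon C)) (t : Mon C), t.IsRoot ∧
      (w.map Mon.content).sum + t.content = m.content ∧
      act (word w) (Finsupp.single t 1) = a} := by
  have root (m : Mon C) (h : m.IsRoot) :
      Finsupp.single m 1 ∈ Submodule.span ℝ {a | ∃ (w : List (Mon C)) (t : Mon C), t.IsRoot ∧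
        (w.map Mon.content).sum + t.content = m.content ∧
        act (word w) (Finsupp.single t 1) = a} :=
    Submodule.subset_span ⟨[], m, h, by simp, by simp [word, act_one]⟩
  induction m with
  | gen c => exact root _ trivial
  | brk s t => exact root _ trivial
  | tri s t _ ih =>
    rw [← tri_single]
    refine map_mem_of_mem_span (tri (Finsupp.single s 1)) ?_ ih
    rintro _ ⟨w, t', h1, h2, rfl⟩
    have h3 := act_inc_mul (Finsupp.single s 1) (word w) (Finsupp.single t' 1)
    rw [eq_sub_iff_add_eq] at h3
    rw [← h3]
    refine add_mem (Submodule.subset_span ⟨s :: w, t', h1, ?_, by rw [word_cons]⟩) ?_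
    · simp [Mon.content, ← h2, add_assoc]
    · rw [der_single_word]
      refine map_mem_of_mem_span (act.flip (Finsupp.single t' 1))
        (S := {p | ∃ w' ∈ graftAt s w, word w' = p}) ?_ (list_sum_mem fun p hp => ?_)
      · rintro _ ⟨w', hw', rfl⟩
        refine Submodule.subset_span ⟨w', t', h1, ?_, rfl⟩
        rw [content_of_mem_graftAt hw', Mon.content, ← h2, add_assoc]
      · obtain ⟨w', h, rfl⟩ := List.mem_map.1 hp
        exact Submodule.subset_span ⟨w', h, rfl⟩

-- Words in `Ŝ` as combinations of OSBB-words

variable [LinearOrder C]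

/-- The linear order on expressions. -/
instance Expr.linearOrder : LinearOrder (Expr C) :=
  letI : DecidableRel (Expr.lt : Expr C → Expr C → Prop) := Classical.decRel _
  linearOrderOfSTO Expr.lt

lemma Expr.lt_iff {x y : Expr C} : x.lt y ↔ x < y := Iff.rfl

lemma Expr.le_iff {x y : Expr C} : x.le y ↔ x ≤ y := by
  rw [Expr.le, le_iff_lt_or_eq, Expr.lt_iff]

/-- The inclusion of `Ŝ` in the tensor algebra. -/
def incS (x : Shat C) : D C := inc x.1.eval

lemma map_incS (l : List (Shat C)) :
    l.map incS = (l.map Subtype.val).map fun x => inc x.eval := by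
  rw [List.map_map]; rfl

lemma pairwise_ofList {l : List (Shat C)} (h : l.Pairwise (fun x y => y ≤ x)) :
    (Exprs.ofList (l.map Subtype.val)).Valid ∧
      (Exprs.ofList (l.map Subtype.val)).toList.Pairwise (fun a b => b.le a) := by
  rw [Exprs.valid_iff, Exprs.toList_ofList, List.pairwise_map]
  refine ⟨fun x hx => ?_, h.imp fun h => Expr.le_iff.2 h⟩
  obtain ⟨y, _, rfl⟩ := List.mem_map.1 hx
  exact y.2

/-- A block of elements of `Ŝ`, followed by a valid block word. -/
lemma valid_block {u : List (Shat C)} {a b : Shat C} (h : IsBlock u a b) {ω : Osbb C}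
    (hω : ω.Valid) : (Osbb.block (.ofList (u.map Subtype.val)) a.1 b.1 ω).Valid := by
  refine ⟨pairwise_ofList h.1, ⟨a.2, b.2, h.2.1, fun x hx => ?_⟩, hω⟩
  rw [Exprs.toList_ofList] at hx
  obtain ⟨y, hy, rfl⟩ := List.mem_map.1 hx
  exact Expr.le_iff.2 (h.2.2 y hy)

lemma eval_block_ofList (u : List (Shat C)) (a b : Shat C) (ω : Osbb C) :
    (Osbb.block (.ofList (u.map Subtype.val)) a.1 b.1 ω).eval =
      symList (u.map incS) * (incS a * incS b - incS b * incS a) * ω.eval := by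
  rw [Osbb.eval_block, Exprs.toList_ofList, map_incS]; rfl

lemma eval_sym_ofList (u : List (Shat C)) :
    (Osbb.sym (.ofList (u.map Subtype.val))).eval = symList (u.map incS) := by
  rw [Osbb.eval_sym, Exprs.toList_ofList, map_incS]

/-- The span of the valid block words with a prescribed multiset of letters. -/
def osbbSpan (l : List (Shat C)) : Submodule ℝ (D C) :=
  Submodule.span ℝ {p | ∃ ω : Osbb C, ω.Valid ∧ ω.letters.Perm (l.map Subtype.val) ∧ ω.eval = p}

/-- The span of the valid block words that begin with a symmetric-bracket block with fewer than `j`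
letters in the symmetric part. -/
def osbbBlockSpan (j : ℕ) (l : List (Shat C)) : Submodule ℝ (D C) :=
  Submodule.span ℝ {p | ∃ xs y z ω, (Osbb.block xs y z ω).Valid ∧ xs.length < j ∧
    (Osbb.block xs y z ω).letters.Perm (l.map Subtype.val) ∧ (Osbb.block xs y z ω).eval = p}

lemma osbbBlockSpan_le (j : ℕ) (l : List (Shat C)) : osbbBlockSpan j l ≤ osbbSpan l :=
  Submodule.span_mono fun _ ⟨_, _, _, _, h1, _, h2, h3⟩ => ⟨_, h1, h2, h3⟩

lemma letters_block_perm {u v l : List (Shat C)} {a b : Shat C} {ω : Osbb C}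
    (hl : (u ++ a :: b :: v).Perm l) (hω : ω.letters.Perm (v.map Subtype.val)) :
    (Osbb.block (.ofList (u.map Subtype.val)) a.1 b.1 ω).letters.Perm (l.map Subtype.val) := by
  refine List.Perm.trans ?_ (hl.map Subtype.val)
  rw [Osbb.letters, Exprs.toList_ofList, List.map_append, List.map_cons, List.map_cons]
  exact (((hω.cons _).cons _).trans (List.Perm.swap _ _ _)).append_left _

lemma block_mul_mem {j : ℕ} {u v l : List (Shat C)} {a b : Shat C} (hb : IsBlock u a b)
    (hj : u.length < j) (hl : (u ++ a :: b :: v).Perm l) {q : D C} (hq : q ∈ osbbSpan v) :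
    symList (u.map incS) * (incS a * incS b - incS b * incS a) * q ∈ osbbBlockSpan j l := by
  refine map_mem_of_mem_span (LinearMap.mulLeft ℝ _) ?_ hq
  rintro _ ⟨ω, h1, h2, rfl⟩
  rw [LinearMap.mulLeft_apply, ← eval_block_ofList]
  refine Submodule.subset_span ⟨_, _, _, _, valid_block hb h1, ?_, letters_block_perm hl h2, rfl⟩
  rwa [← Exprs.length_toList, Exprs.toList_ofList, List.length_map]

/-- The symmetrization of the word is an OSBB-word after sorting. The rest begins with ordered
blocks, and each block uses up at least two letters, so the remaining tails are covered by induction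
on length. -/
lemma list_prod_mem_osbbSpan (l : List (Shat C)) : (l.map incS).prod ∈ osbbSpan l := by
  induction hn : l.length using Nat.strong_induction_on generalizing l with
  | _ n ih =>
    have h := symBracketSpan_le_blockSpan _ _ (wordBracketSpan_le_symBracketSpan _ _
      (prod_sub_symList_mem (f := incS) l))
    rw [← sub_add_cancel (l.map incS).prod (symList (l.map incS))]
    refine add_mem (osbbBlockSpan_le (l.length - 1) l (Submodule.span_le.2 ?_ h)) ?_
    · rintro _ ⟨u, a, b, v, h0, h1, h2, rfl⟩
      have h3 := h2.length_eq
      simp only [List.length_append, List.length_cons] at h3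
      exact block_mul_mem h0 h1 h2 (ih v.length (by omega) v rfl)
    · have hp := List.perm_insertionSort (fun x y : Shat C => y ≤ x) l
      rw [← symList_perm (hp.map incS), ← eval_sym_ofList]
      refine Submodule.subset_span ⟨.sym _,
        pairwise_ofList (List.pairwise_insertionSort _ l), ?_, rfl⟩
      rw [Osbb.letters, Exprs.toList_ofList]
      exact hp.map _

lemma blockSpan_le_osbbBlockSpan (j : ℕ) (l : List (Shat C)) :
    blockSpan incS j l ≤ osbbBlockSpan j l := by
  refine Submodule.span_le.2 ?_
  rintro _ ⟨u, a, b, v, h0, h1, h2, rfl⟩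
  exact block_mul_mem h0 h1 h2 (list_prod_mem_osbbSpan v)

/-! ### The elements of `Ŝ` span -/

/-- The span of the elements of `Ŝ` with a given content. -/
def shatSpan (μ : Multiset C) : Submodule ℝ (A C) :=
  Submodule.span ℝ {a | ∃ x : Shat C, x.1.content = μ ∧ x.1.eval = a}

/-- The span of the roots of elements of `Ŝ` with a given content. -/
def rootSpan (μ : Multiset C) : Submodule ℝ (A C) :=
  Submodule.span ℝ {a | ∃ r : Root C, r.Valid ∧ r.content = μ ∧ r.eval = a}

/-- The span of the words of elements of `Ŝ` with a given content and length. -/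
def shatWordSpan (μ : Multiset C) (k : ℕ) : Submodule ℝ (D C) :=
  Submodule.span ℝ {p | ∃ l : List (Shat C), (l.map fun x => x.1.content).sum = μ ∧ l.length = k ∧
    (l.map incS).prod = p}

lemma content_eq_of_perm {ω : Osbb C} {l : List (Shat C)}
    (h : ω.letters.Perm (l.map Subtype.val)) :
    ω.content = (l.map fun x => x.1.content).sum := by
  rw [ω.content_eq, (h.map _).sum_eq, List.map_map]; rfl

lemma length_eq_of_perm {ω : Osbb C} {l : List (Shat C)}
    (h : ω.letters.Perm (l.map Subtype.val)) : ω.length = l.length := by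
  rw [← ω.length_letters, h.length_eq, List.length_map]

lemma act_mem_shatSpan {μ ν : Multiset C} {k : ℕ} {p : D C} {a : A C} (hp : p ∈ shatWordSpan μ k)
    (ha : a ∈ rootSpan ν) : act p a ∈ shatSpan (μ + ν) := by
  refine map₂_mem_of_mem_span act ?_ hp ha
  rintro _ ⟨l, rfl, rfl, rfl⟩ _ ⟨r, hr, rfl, rfl⟩
  refine map_mem_of_mem_span (act.flip r.eval) ?_ (list_prod_mem_osbbSpan l)
  rintro _ ⟨ω, h1, h2, rfl⟩
  refine Submodule.subset_span ⟨⟨.mk ω r, h1, hr⟩, ?_, ?_⟩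
  · rw [Expr.content, content_eq_of_perm h2]
  · rw [Expr.eval]; rfl

lemma word_mem_shatWordSpan (w : List (Mon C))
    (h : ∀ m ∈ w, Finsupp.single m 1 ∈ shatSpan m.content) :
    word w ∈ shatWordSpan (w.map Mon.content).sum w.length := by
  induction w with
  | nil => exact Submodule.subset_span ⟨[], by simp, by simp, by simp [word]⟩
  | cons m w ih =>
    rw [word_cons]
    refine map₂_mem_of_mem_span ((LinearMap.mul ℝ (D C)).comp inc) ?_
      (h m List.mem_cons_self) (ih fun m hm => h m (List.mem_cons_of_mem _ hm))
    rintro _ ⟨x, hx, rfl⟩ _ ⟨l, h1, h2, rfl⟩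
    exact Submodule.subset_span ⟨x :: l, by
      rw [List.map_cons, List.sum_cons, hx, h1, List.map_cons, List.sum_cons], by simp [h2],
      by simp [incS]⟩

/-- In a term `w ▷ t` the contents add up to that of the monomial, and the root `t` has at least one
vertex. The letters of `w`, and the two entries of a bracket root, therefore have fewer vertices,
and the induction hypothesis applies to them. -/
theorem single_mem_shatSpan (m : Mon C) : Finsupp.single m 1 ∈ shatSpan m.content := by
  induction hn : m.vert using Nat.strong_induction_on generalizing m with
  | _ n ih =>
    refine Submodule.span_le.2 ?_ (single_mem_span_act m)
    rintro _ ⟨w, t, ht, h, rfl⟩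
    have hc := congrArg Multiset.card h
    rw [Multiset.card_add, m.card_content, t.card_content, hn] at hc
    rw [← h]
    have hw (s : Mon C) (hs : s ∈ w) : s.content.card ≤ (w.map Mon.content).sum.card :=
      Multiset.card_le_card (List.single_le_sum (by simp) _ (List.mem_map_of_mem hs))
    refine act_mem_shatSpan (word_mem_shatWordSpan w fun s hs => ih s.vert ?_ s rfl) ?_
    · have := hw s hs
      have := t.vert_pos
      rw [s.card_content] at *
      omega
    · cases t with
      | gen c =>
        exact Submodule.subset_span ⟨.gen c, trivial, rfl, by rw [Root.eval]; rfl⟩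
      | brk s t =>
        rw [Mon.vert] at hc
        have := s.vert_pos
        have := t.vert_pos
        rw [← brk_single, Mon.content]
        refine map₂_mem_of_mem_span brk ?_ (ih s.vert (by omega) s rfl) (ih t.vert (by omega) t rfl)
        rintro _ ⟨x, hx, rfl⟩ _ ⟨y, hy, rfl⟩
        exact Submodule.subset_span ⟨.brk x.1 y.1, ⟨x.2, y.2⟩, by rw [Root.content, hx, hy],
          by rw [Root.eval]⟩
      | tri s t => exact ht.elim

end

/-! ### Counting -/

section

variable {C : Type u}

/-- Both factors of a composite monomial have content below `μ` and of smaller cardinality, and a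
multiset has finitely many submultisets. -/
lemma Mon.finite_content_eq (μ : Multiset C) : {m : Mon C | m.content = μ}.Finite := by
  induction hn : μ.card using Nat.strong_induction_on generalizing μ with
  | _ n ih =>
    have hfin : {ν : Multiset C | ν ≤ μ ∧ ν.card < n}.Finite :=
      μ.powerset.finite_toSet.subset fun ν h => Multiset.mem_powerset.2 h.1
    have h1 : (⋃ ν ∈ {ν : Multiset C | ν ≤ μ ∧ ν.card < n}, {m : Mon C | m.content = ν}).Finite :=
      hfin.biUnion fun ν hν => ih _ hν.2 ν rfl
    refine (((μ.finite_toSet.image Mon.gen).union (h1.image2 Mon.brk h1)).union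
      (h1.image2 Mon.tri h1)).subset ?_
    rintro m rfl
    have hmem {s t : Mon C} (h : s.content + t.content = m.content) :
        s ∈ (⋃ ν ∈ {ν : Multiset C | ν ≤ m.content ∧ ν.card < n}, {m : Mon C | m.content = ν}) ∧
        t ∈ (⋃ ν ∈ {ν : Multiset C | ν ≤ m.content ∧ ν.card < n}, {m : Mon C | m.content = ν}) := by
      have h2 := congrArg Multiset.card h
      have h3 := s.vert_pos
      have h4 := t.vert_pos
      rw [Multiset.card_add, hn] at h2
      rw [← s.card_content] at h3
      rw [← t.card_content] at h4
      simp only [Set.mem_ofPred_eq, Set.mem_iUnion, exists_prop, exists_eq_right']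
      exact ⟨⟨h ▸ Multiset.le_add_right _ _, by omega⟩, ⟨h ▸ Multiset.le_add_left _ _, by omega⟩⟩
    cases m with
    | gen c => exact .inl (.inl ⟨c, by simp [Mon.content], rfl⟩)
    | brk s t =>
      obtain ⟨hs, ht⟩ := hmem (s := s) (t := t) rfl
      exact .inl (.inr ⟨s, hs, t, ht, rfl⟩)
    | tri s t =>
      obtain ⟨hs, ht⟩ := hmem (s := s) (t := t) rfl
      exact .inr ⟨s, hs, t, ht, rfl⟩

mutual

/-- The monomial `x₁ ▷ (x₂ ▷ ⋯ (xₙ ▷ r))` for the letters `x₁, …, xₙ` of an expression `ω ▷ r`. -/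
def Expr.mon : Expr C → Mon C
  | .mk ω r => ω.mon r.mon

/-- The monomial of a root. -/
def Root.mon : Root C → Mon C
  | .gen c => .gen c
  | .brk u v => .brk u.mon v.mon

/-- The operation `m ↦ x₁ ▷ (x₂ ▷ ⋯ (xₙ ▷ m))` for the letters `x₁, …, xₙ` of a block word. -/
def Osbb.mon : Osbb C → Mon C → Mon C
  | .sym xs, m => xs.mon m
  | .block xs y z ω, m => xs.mon (.tri z.mon (.tri y.mon (ω.mon m)))

/-- The operation `m ↦ x₁ ▷ (x₂ ▷ ⋯ (xₙ ▷ m))`. -/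
def Exprs.mon : Exprs C → Mon C → Mon C
  | .nil, m => m
  | .cons x xs, m => .tri x.mon (xs.mon m)

end

lemma Exprs.mon_eq (m : Mon C) :
    (xs : Exprs C) → xs.mon m = (xs.toList.map Expr.mon).foldr Mon.tri m
  | .nil => by simp [mon, toList]
  | .cons x xs => by simp [mon, toList, xs.mon_eq m]

lemma Osbb.mon_eq (m : Mon C) :
    (ω : Osbb C) → ω.mon m = (ω.letters.map Expr.mon).foldr Mon.tri m
  | .sym xs => xs.mon_eq m
  | .block xs y z ω => by simp [mon, letters, xs.mon_eq, ω.mon_eq]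

mutual

lemma Expr.content_mon (x : Expr C) : x.mon.content = x.content := by
  obtain ⟨ω, r⟩ := x
  rw [Expr.mon, Expr.content, ω.content_mon, r.content_mon]

lemma Root.content_mon (r : Root C) : r.mon.content = r.content := by
  cases r with
  | gen c => rw [Root.mon, Root.content, Mon.content]
  | brk u v => rw [Root.mon, Root.content, Mon.content, u.content_mon, v.content_mon]

lemma Osbb.content_mon (ω : Osbb C) (m : Mon C) :
    (ω.mon m).content = ω.content + m.content := by
  cases ω with
  | sym xs => rw [Osbb.mon, Osbb.content, xs.content_mon]
  | block xs y z ω =>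
    rw [Osbb.mon, Osbb.content, xs.content_mon, Mon.content, Mon.content, ω.content_mon,
      y.content_mon, z.content_mon]
    abel

lemma Exprs.content_mon (xs : Exprs C) (m : Mon C) :
    (xs.mon m).content = xs.content + m.content := by
  cases xs with
  | nil => rw [Exprs.mon, Exprs.content, zero_add]
  | cons x xs =>
    rw [Exprs.mon, Exprs.content, Mon.content, x.content_mon, xs.content_mon, add_assoc]

end

lemma Root.isRoot_mon (r : Root C) : r.mon.IsRoot := by
  cases r <;> simp [Root.mon, Mon.IsRoot]

/-- The right spine of a monomial ends at the first node that is not a product `▷`; the hypotheses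
on `t` and `t'` make this end point unambiguous. -/
lemma foldr_tri_injective {l l' : List (Mon C)} {t t' : Mon C} (ht : t.IsRoot) (ht' : t'.IsRoot)
    (h : l.foldr Mon.tri t = l'.foldr Mon.tri t') : l = l' ∧ t = t' := by
  induction l generalizing l' with
  | nil =>
    cases l' with
    | nil => exact ⟨rfl, h⟩
    | cons s l' => subst h; exact ht.elim
  | cons s l ih =>
    cases l' with
    | nil => subst h; exact ht'.elim
    | cons s' l' =>
      simp only [List.foldr_cons, Mon.tri.injEq] at h
      obtain ⟨h1, h2⟩ := ih h.2
      exact ⟨by rw [h.1, h1], h2⟩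

lemma Osbb.vert_le_of_mem_letters {ω : Osbb C} {x : Expr C} (hx : x ∈ ω.letters) :
    x.vert ≤ ω.vert := by
  rw [← x.card_content, ← ω.card_content, ω.content_eq]
  exact Multiset.card_le_card (List.single_le_sum (by simp) _ (List.mem_map_of_mem hx))

lemma map_injOn {X Y : Type*} {f : X → Y} {l l' : List X}
    (h : ∀ x ∈ l, ∀ y ∈ l', f x = f y → x = y) (hl : l.map f = l'.map f) : l = l' := by
  induction l generalizing l' with
  | nil => simpa [eq_comm] using hl
  | cons x l ih =>
    cases l' with
    | nil => simp at hl
    | cons y l' =>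
      simp only [List.map_cons, List.cons.injEq] at hl
      rw [h x List.mem_cons_self y List.mem_cons_self hl.1, ih (fun x hx y hy =>
        h x (List.mem_cons_of_mem _ hx) y (List.mem_cons_of_mem _ hy)) hl.2]

/-- The first ascent of a list determines its position. -/
lemma eq_of_append_ascent {X : Type*} [LinearOrder X] {a a' b b' : List X} {y y' z z' : X}
    (ha : ∀ x ∈ a, z ≤ x) (ha2 : a.Pairwise (fun x y => y ≤ x)) (hzy : z < y)
    (ha' : ∀ x ∈ a', z' ≤ x) (ha2' : a'.Pairwise (fun x y => y ≤ x)) (hzy' : z' < y')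
    (h : a ++ z :: y :: b = a' ++ z' :: y' :: b') : a = a' ∧ z = z' ∧ y = y' ∧ b = b' := by
  induction a generalizing a' with
  | nil =>
    cases a' with
    | nil => simpa using h
    | cons x a' =>
      exfalso
      simp only [List.nil_append, List.cons_append, List.cons.injEq] at h
      obtain ⟨rfl, h⟩ := h
      cases a' with
      | nil =>
        simp only [List.nil_append, List.cons.injEq] at h
        exact absurd (ha' z List.mem_cons_self) (not_le.2 (h.1 ▸ hzy))
      | cons x' a' =>
        simp only [List.cons_append, List.cons.injEq] at h
        rw [List.pairwise_cons] at ha2'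
        exact absurd (ha2'.1 x' List.mem_cons_self) (not_le.2 (h.1 ▸ hzy))
  | cons x a ih =>
    cases a' with
    | nil =>
      exfalso
      simp only [List.nil_append, List.cons_append, List.cons.injEq] at h
      obtain ⟨rfl, h⟩ := h
      cases a with
      | nil =>
        simp only [List.nil_append, List.cons.injEq] at h
        exact absurd (ha x List.mem_cons_self) (not_le.2 (h.1 ▸ hzy'))
      | cons x' a =>
        simp only [List.cons_append, List.cons.injEq] at h
        rw [List.pairwise_cons] at ha2
        exact absurd (ha2.1 x' List.mem_cons_self) (not_le.2 (h.1 ▸ hzy'))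
    | cons x' a' =>
      simp only [List.cons_append, List.cons.injEq] at h
      rw [List.pairwise_cons] at ha2 ha2'
      obtain ⟨h1, h2⟩ := ih (fun x hx => ha x (List.mem_cons_of_mem _ hx)) ha2.2
        (fun x hx => ha' x (List.mem_cons_of_mem _ hx)) ha2'.2 h.2
      exact ⟨by rw [h.1, h1], h2⟩

end

section

variable {C : Type u} [LinearOrder C]

lemma not_pairwise_of_ascent {a b : List (Expr C)} {y z : Expr C} (hzy : z < y) :
    ¬ (a ++ z :: y :: b).Pairwise (fun x y => y ≤ x) := fun h =>
  absurd ((List.pairwise_cons.1 (List.pairwise_append.1 h).2.1).1 y List.mem_cons_self)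
    (not_le.2 hzy)

/-- The letters of a symmetric word decrease weakly, while each bracket contributes the ascent `z`,
`y`. The first ascent thus tells whether there is a bracket and where the first block ends. -/
lemma Osbb.letters_injOn : (ω η : Osbb C) → ω.Valid → η.Valid → ω.letters = η.letters → ω = η
  | .sym xs, .sym ys, _, _, h => by rw [Exprs.toList_injective h]
  | .sym xs, .block ys y z η, h1, h2, h => by
    have := h1.2
    simp only [Expr.le_iff] at this
    rw [show xs.toList = _ from h] at this
    exact absurd this (not_pairwise_of_ascent h2.2.1.2.2.1)
  | .block xs y z ω, .sym ys, h1, h2, h => by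
    have := h2.2
    simp only [Expr.le_iff] at this
    rw [show ys.toList = _ from h.symm] at this
    exact absurd this (not_pairwise_of_ascent h1.2.1.2.2.1)
  | .block xs y z ω, .block ys y' z' η, h1, h2, h => by
    have p1 := h1.1.2
    have p2 := h2.1.2
    have q1 := h1.2.1.2.2.2
    have q2 := h2.2.1.2.2.2
    simp only [Expr.le_iff] at p1 p2 q1 q2
    obtain ⟨h3, h4, h5, h6⟩ := eq_of_append_ascent q1 p1 h1.2.1.2.2.1 q2 p2 h2.2.1.2.2.1 h
    rw [Exprs.toList_injective h3, h4, h5, letters_injOn ω η h1.2.2 h2.2.2 h6]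

lemma Osbb.valid_of_mem_letters : (ω : Osbb C) → ω.Valid → ∀ x ∈ ω.letters, x.Valid
  | .sym xs, h => xs.valid_iff.1 h.1
  | .block xs y z ω, h => by
    intro x hx
    rw [Osbb.letters] at hx
    simp only [List.mem_append, List.mem_cons] at hx
    rcases hx with hx | rfl | rfl | hx
    · exact xs.valid_iff.1 h.1.1 x hx
    · exact h.2.1.2.1
    · exact h.2.1.1
    · exact valid_of_mem_letters ω h.2.2 x hx

/-- The spine of the monomial gives back the root and the monomials of the letters. All letters, and
the entries of a bracket root, have fewer vertices, so they are recovered by induction; validity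
then determines the block word from its letters. -/
lemma Expr.mon_injOn (x y : Expr C) (hx : x.Valid) (hy : y.Valid) (h : x.mon = y.mon) :
    x = y := by
  induction hn : x.vert using Nat.strong_induction_on generalizing x y with
  | _ n ih =>
    obtain ⟨ω, r⟩ := x
    obtain ⟨η, s⟩ := y
    rw [Expr.mon, Expr.mon, ω.mon_eq, η.mon_eq] at h
    obtain ⟨h1, h2⟩ := foldr_tri_injective r.isRoot_mon s.isRoot_mon h
    rw [Expr.vert] at hn
    have hr := r.vert_pos
    have hωη : ω = η := Osbb.letters_injOn ω η hx.1 hy.1 (map_injOn (fun x hx' y hy' hxy =>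
      ih x.vert (by have := Osbb.vert_le_of_mem_letters hx'; omega) x y
        (ω.valid_of_mem_letters hx.1 x hx') (η.valid_of_mem_letters hy.1 y hy') hxy rfl) h1)
    have hrs : r = s := by
      cases r with
      | gen c => cases s <;> simp_all [Root.mon]
      | brk u v =>
        cases s with
        | gen d => simp [Root.mon] at h2
        | brk u' v' =>
          simp only [Root.mon, Mon.brk.injEq] at h2
          rw [Root.vert] at hn
          have hu := u.vert_pos
          have hv := v.vert_pos
          rw [ih u.vert (by omega) u u' hx.2.1 hy.2.1 h2.1 rfl,
            ih v.vert (by omega) v v' hx.2.2 hy.2.2 h2.2 rfl]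
    rw [hωη, hrs]

lemma shat_mon_injective : Function.Injective fun x : Shat C => x.1.mon :=
  fun x y h => Subtype.ext (Expr.mon_injOn _ _ x.2 y.2 h)

lemma Shat.finite_content_mem {F : Set (Multiset C)} (hF : F.Finite) :
    {x : Shat C | x.1.content ∈ F}.Finite := by
  have h : {m : Mon C | m.content ∈ F}.Finite :=
    (hF.biUnion fun μ _ => Mon.finite_content_eq μ).subset fun m hm => by simpa using hm
  refine (h.preimage shat_mon_injective.injOn).subset fun x hx => ?_
  simpa [Expr.content_mon] using hx

/-- A family indexed by `Ŝ` that spans each space of elements with a given content is linearly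
independent. -/
theorem linearIndependent_of_span (v : Shat C → A C)
    (h : ∀ m : Mon C, Finsupp.single m 1 ∈
      Submodule.span ℝ {a | ∃ x : Shat C, x.1.content = m.content ∧ v x = a}) :
    LinearIndependent ℝ v := by
  classical
  rw [linearIndependent_iff_finset_linearIndependent]
  intro s
  let F : Set (Multiset C) := (fun x : Shat C => x.1.content) '' (s : Set (Shat C))
  have hF : F.Finite := s.finite_toSet.image _
  have hS := Shat.finite_content_mem hF
  have hM : {m : Mon C | m.content ∈ F}.Finite :=
    (hF.biUnion fun μ _ => Mon.finite_content_eq μ).subset fun m hm => by simpa using hm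
  let S := {x : Shat C | x.1.content ∈ F}
  let T := {m : Mon C | m.content ∈ F}
  have : Fintype S := hS.fintype
  have : Fintype T := hM.fintype
  -- All indices with a content in `F` are taken together. They inject into the monomials with
  -- content in `F`, whose span has dimension `card T` and lies in the span of the family, so the
  -- family has no more members than the dimension of its span.
  have key : LinearIndependent ℝ fun x : S => v x.1 := by
    rw [linearIndependent_iff_card_le_finrank_span]
    have hT : LinearIndependent ℝ fun m : T => (Finsupp.single m.1 1 : A C) :=
      (Finsupp.basisSingleOne (R := ℝ) (ι := Mon C)).linearIndependent.comp _
        Subtype.val_injective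
    have h1 : Fintype.card S ≤ Fintype.card T :=
      Fintype.card_le_of_injective (fun x => ⟨x.1.1.mon, by
        have := x.2; simpa only [T, S, Set.mem_ofPred_eq, Expr.content_mon] using this⟩)
        fun x y hxy => Subtype.ext (shat_mon_injective (congrArg Subtype.val hxy))
    have h2 : Set.finrank ℝ (Set.range fun m : T => (Finsupp.single m.1 1 : A C)) =
        Fintype.card T := finrank_span_eq_card hT
    rw [← h2] at h1
    have := FiniteDimensional.span_of_finite ℝ (Set.finite_range fun x : S => v x.1)
    refine h1.trans (Submodule.finrank_mono (Submodule.span_le.2 ?_))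
    rintro _ ⟨m, rfl⟩
    refine Submodule.span_mono ?_ (h m.1)
    rintro _ ⟨x, hx, rfl⟩
    exact ⟨⟨x, by have := m.2; simpa only [S, T, Set.mem_ofPred_eq, hx] using this⟩, rfl⟩
  exact key.comp (fun x : s => ⟨x.1, x.1, x.2, rfl⟩) fun x y hxy =>
    Subtype.ext (congrArg (fun z : S => z.1) hxy)

end

/-! ### Triangularity -/

noncomputable section

section

variable {C : Type u}

lemma act_mem_of_mem_lowD {μ : Multiset C} {k : ℕ} {e : D C} {a : A C} {Q : Submodule ℝ (A C)}
    (he : e ∈ lowD μ k) (h : ∀ j < k, ∀ p ∈ homD μ j, act p a ∈ Q) : act e a ∈ Q := by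
  refine map_mem_of_mem_span (act.flip a) ?_ he
  rintro _ ⟨w, rfl, hw, rfl⟩
  exact h _ hw _ (word_mem_homD w)

lemma exists_act_act_eq_of_mem_lowD {μ ν : Multiset C} {j k : ℕ} {p q : D C} (hp : p ∈ lowD μ j)
    (hq : q ∈ homD ν k) : ∃ e ∈ lowD (μ + ν) (j + k), ∀ a, act p (act q a) = act e a := by
  induction hp using Submodule.span_induction with
  | mem p hp =>
    obtain ⟨w, rfl, hw, rfl⟩ := hp
    obtain ⟨e, he, h⟩ := exists_act_act_eq (word_mem_homD w) hq
    refine ⟨word w * q + e, add_mem ?_ (lowD_mono (by omega) he), fun a => by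
      rw [h, map_add, LinearMap.add_apply]⟩
    exact homD_le_lowD (by omega) (mul_mem_homD (word_mem_homD w) hq)
  | zero => exact ⟨0, Submodule.zero_mem _, fun a => by simp⟩
  | add p p' _ _ h h' =>
    obtain ⟨e, he, h⟩ := h
    obtain ⟨e', he', h'⟩ := h'
    exact ⟨e + e', add_mem he he', fun a => by simp [h, h']⟩
  | smul c p _ h =>
    obtain ⟨e, he, h⟩ := h
    exact ⟨c • e, Submodule.smul_mem _ c he, fun a => by simp [h]⟩

lemma exists_act_act_act_eq {μ ν ξ : Multiset C} {i j k : ℕ} {p c q : D C} (hp : p ∈ homD μ i)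
    (hc : c ∈ homD ν j) (hq : q ∈ homD ξ k) :
    ∃ e ∈ lowD (μ + ν + ξ) (i + j + k),
      ∀ a, act p (act c (act q a)) = act (p * c * q) a + act e a := by
  obtain ⟨e₁, he₁, h₁⟩ := exists_act_act_eq hp hc
  obtain ⟨e₂, he₂, h₂⟩ := exists_act_act_eq (mul_mem_homD hp hc) hq
  obtain ⟨e₃, he₃, h₃⟩ := exists_act_act_eq_of_mem_lowD he₁ hq
  exact ⟨e₂ + e₃, add_mem he₂ he₃, fun a => by
    rw [h₁, h₂, h₃, map_add, LinearMap.add_apply, add_assoc]⟩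

end

section Symmetrize

variable {R : Type*} [Ring R] [Algebra ℝ R]

/-- The symmetrized product as a multilinear map. -/
def symMul (n : ℕ) : MultilinearMap ℝ (fun _ : Fin n => R) R :=
  ((n.factorial : ℝ)⁻¹) • ∑ σ : Equiv.Perm (Fin n),
    (MultilinearMap.mkPiAlgebraFin ℝ n R).domDomCongr σ⁻¹

lemma symMul_apply {n : ℕ} (x : Fin n → R) : symMul n x = symProd x := by
  simp [symMul, symProd]

end Symmetrize

-- Sorting lists that are pointwise below a sorted list

section Sorting

variable {X : Type*} [LinearOrder X]

/-- When `x'` moves past a larger `a'`, the bounds survive because `a' ≤ a ≤ x` and `x' < a' ≤ a`. A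
genuine move leaves `x'` strictly below its new bound, so equality with the sorted list forces that
nothing moved. -/
lemma orderedInsert_le {x x' : X} {t t' : List X} (h : List.Forall₂ (· ≤ ·) (x' :: t') (x :: t))
    (hs : (x :: t).Pairwise (fun x y => y ≤ x)) :
    List.Forall₂ (· ≤ ·) (t'.orderedInsert (fun x y => y ≤ x) x') (x :: t) ∧
      (t'.orderedInsert (fun x y => y ≤ x) x' = x :: t → x' :: t' = x :: t) := by
  induction t' generalizing x x' t with
  | nil => exact ⟨h, id⟩
  | cons a' t' ih =>
    by_cases hax : a' ≤ x'
    · rw [List.orderedInsert_cons_of_le (fun x y : X => y ≤ x) _ hax]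
      exact ⟨h, id⟩
    · rw [List.orderedInsert_of_not_le (fun x y : X => y ≤ x) _ hax]
      cases h with
      | cons h1 h2 =>
        cases h2 with
        | @cons _ a _ t h2 h3 =>
          rw [List.pairwise_cons] at hs
          have hax' := not_le.1 hax
          obtain ⟨h4, h5⟩ := ih (List.Forall₂.cons (hax'.le.trans h2) h3) hs.2
          refine ⟨List.Forall₂.cons (h2.trans (hs.1 a List.mem_cons_self)) h4, fun h6 => ?_⟩
          rw [List.cons.injEq] at h6
          have h7 := h5 h6.2
          rw [List.cons.injEq] at h7
          exact absurd (hax'.trans_le h2) (h7.1 ▸ lt_irrefl _)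

/-- Sorting a list that is pointwise below a sorted list. -/
lemma insertionSort_le {l l' : List X} (h : List.Forall₂ (· ≤ ·) l' l)
    (hs : l.Pairwise (fun x y => y ≤ x)) :
    List.Forall₂ (· ≤ ·) (l'.insertionSort fun x y => y ≤ x) l ∧
      (l'.insertionSort (fun x y => y ≤ x) = l → l' = l) := by
  induction h with
  | nil => exact ⟨.nil, id⟩
  | @cons x' x l' l h1 h2 ih =>
    obtain ⟨h3, h4⟩ := ih (List.pairwise_cons.1 hs).2
    obtain ⟨h5, h6⟩ := orderedInsert_le (List.Forall₂.cons h1 h3) hs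
    refine ⟨h5, fun h => ?_⟩
    have h7 := h6 h
    rw [List.cons.injEq] at h7
    rw [h7.1, h4 h7.2]

end Sorting

-- Lower terms with the same content

variable {C : Type u} [LinearOrder C]

lemma lexLt_of_forall₂ {l l' : List (Shat C)} (h : List.Forall₂ (· ≤ ·) l' l) (hne : l' ≠ l) :
    (Exprs.ofList (l'.map Subtype.val)).lexLt (.ofList (l.map Subtype.val)) := by
  induction h with
  | nil => exact absurd rfl hne
  | @cons x' x l' l h1 h2 ih =>
    simp only [List.map_cons, Exprs.ofList, Exprs.lexLt]
    rcases h1.lt_or_eq with h | rfl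
    · exact .inl h
    · exact .inr ⟨rfl, ih fun h => hne (by rw [h])⟩

lemma Exprs.exists_eq_ofList (xs : Exprs C) (h : xs.Valid) :
    ∃ l : List (Shat C), xs = .ofList (l.map Subtype.val) := by
  refine ⟨xs.toList.attachWith _ (xs.valid_iff.1 h), ?_⟩
  rw [List.attachWith_map_subtype_val, Exprs.ofList_toList]

/-- The elements of `Ŝ` below `x`, with the same content. -/
def below (x : Shat C) : Set (Shat C) := {y | y.1.content = x.1.content ∧ y ≤ x}

/-- The span of the elements of `Ŝ` strictly below `x`, with the same content. -/
def lowSpan (x : Shat C) : Submodule ℝ (A C) :=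
  Submodule.span ℝ ((fun y : Shat C => y.1.eval) '' (below x \ {x}))

/-- The roots below `r`, with the same content. -/
def belowRoot (r : Root C) : Set (Root C) :=
  {s | s.Valid ∧ s.content = r.content ∧ (s = r ∨ s.lt r)}

/-- The lists that are pointwise below `l`. -/
def belowList (l : List (Shat C)) : Set (List (Shat C)) :=
  {l' | List.Forall₂ (fun y x => y ∈ below x) l' l}

lemma self_mem_below (x : Shat C) : x ∈ below x := ⟨rfl, le_rfl⟩

lemma self_mem_belowList (l : List (Shat C)) : l ∈ belowList l :=
  List.forall₂_same.2 fun x _ => self_mem_below x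

lemma content_of_mem_belowList {l l' : List (Shat C)} (h : l' ∈ belowList l) :
    (l'.map fun x => x.1.content).sum = (l.map fun x : Shat C => x.1.content).sum := by
  change List.Forall₂ _ _ _ at h
  induction h with
  | nil => rfl
  | cons h1 _ ih => rw [List.map_cons, List.map_cons, List.sum_cons, List.sum_cons, h1.1, ih]

lemma length_of_mem_belowList {l l' : List (Shat C)} (h : l' ∈ belowList l) :
    l'.length = l.length := List.Forall₂.length_eq h

/-- Symmetrization is multilinear, so lower terms in the letters expand into tuples that are
pointwise below `l` and differ from it. These tuples need not be sorted. -/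
lemma symList_phi_sub_mem (l : List (Shat C)) (h : ∀ x ∈ l, x.1.phi - x.1.eval ∈ lowSpan x) :
    symList (l.map fun x => inc x.1.phi) - symList (l.map incS) ∈
      Submodule.span ℝ ((fun l' : List (Shat C) => symList (l'.map incS)) ''
        (belowList l \ {l})) := by
  have h1 := multilinear_sub_mem_span (symMul (R := D C) l.length) incS
    (fun i => below (l.get i)) (a := fun i => inc (l.get i).1.phi) (k₀ := l.get)
    (fun i => self_mem_below _) (fun i => by
      rw [incS, ← map_sub]
      refine map_mem_of_mem_span inc ?_ (h _ (List.get_mem l i))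
      rintro _ ⟨y, hy, rfl⟩
      exact Submodule.subset_span ⟨y, hy, rfl⟩)
  rw [symMul_apply, symMul_apply, ← symList_map incS l,
    ← symList_map (fun x : Shat C => inc x.1.phi) l] at h1
  refine Submodule.span_mono ?_ h1
  rintro _ ⟨k, ⟨hk1, hk2⟩, rfl⟩
  refine ⟨List.ofFn k, ⟨?_, ?_⟩, ?_⟩
  · refine List.forall₂_iff_get.2 ⟨by simp, fun i h1 h2 => ?_⟩
    simpa using hk1 ⟨i, h2⟩
  · exact fun h => hk2 (List.ofFn_injective (h.trans (List.ofFn_get l).symm))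
  · simp only [List.map_ofFn, symMul_apply]
    rw [← symProd_eq_symList]
    rfl

/-- The order on expressions with the same content and block words with as many vertices. -/
lemma Expr.lt_of_blockLt {ω η : Osbb C} {r s : Root C}
    (hc : (Expr.mk η s).content = (Expr.mk ω r).content)
    (hω : η.content.card = ω.content.card) (hl : η.length = ω.length) (h : η.blockLt ω) :
    (Expr.mk η s).lt (.mk ω r) := by
  have := congrArg Multiset.card hc
  rw [Expr.card_content, Expr.card_content] at this
  rw [η.card_content, ω.card_content] at hω
  rw [Expr.lt]
  exact .inr ⟨this, .inr (.inl ⟨hω, .inr ⟨hl, h⟩⟩)⟩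

lemma eval_mem_lowSpan {x : Shat C} {y : Expr C} (hy : y.Valid)
    (hc : y.content = x.1.content) (hlt : y.lt x.1) : y.eval ∈ lowSpan x :=
  Submodule.subset_span ⟨⟨y, hy⟩, ⟨⟨hc, le_of_lt hlt⟩, fun h => by
    obtain rfl : y = x.1 := congrArg Subtype.val h
    exact Expr.lt_irrefl _ hlt⟩, rfl⟩

lemma homD_le_shatWordSpan (μ : Multiset C) (k : ℕ) : homD μ k ≤ shatWordSpan μ k := by
  refine Submodule.span_le.2 ?_
  rintro _ ⟨w, rfl, rfl, rfl⟩
  exact word_mem_shatWordSpan w fun m _ => single_mem_shatSpan m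

/-- Words with fewer vertices, or as many vertices and fewer letters, give lower terms. -/
lemma act_mem_lowSpan_of_lt {x : Shat C} {ω : Osbb C} {r s : Root C} (hx : x.1 = .mk ω r)
    (hs : s.Valid) {μ : Multiset C} {k : ℕ} {p : D C} (hp : p ∈ homD μ k)
    (hc : μ + s.content = x.1.content)
    (hlt : μ.card < ω.content.card ∨ (μ.card = ω.content.card ∧ k < ω.length)) :
    act p s.eval ∈ lowSpan x := by
  refine map_mem_of_mem_span (act.flip s.eval) ?_ (homD_le_shatWordSpan μ k hp)
  rintro _ ⟨l, rfl, rfl, rfl⟩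
  refine map_mem_of_mem_span (act.flip s.eval) ?_ (list_prod_mem_osbbSpan l)
  rintro _ ⟨η, h1, h2, rfl⟩
  have h3 := content_eq_of_perm h2
  have h4 := length_eq_of_perm h2
  rw [← h3] at hc hlt
  rw [← h4] at hlt
  rw [η.card_content, ω.card_content] at hlt
  have h5 : (Expr.mk η s).eval = act.flip s.eval η.eval := by rw [Expr.eval]; rfl
  rw [← h5]
  refine eval_mem_lowSpan ⟨h1, hs⟩ hc ?_
  have h6 := congrArg Multiset.card hc
  rw [hx] at h6 ⊢
  rw [← Expr.content, Expr.card_content, Expr.card_content] at h6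
  rw [Expr.lt]
  exact .inr ⟨h6, hlt.imp_right fun h => .inl ⟨h.1, .inl h.2⟩⟩

/-- The values of block words that begin with shorter blocks are lower terms. -/
lemma act_mem_lowSpan_of_osbbBlockSpan {x : Shat C} {xs : Exprs C} {y z : Expr C} {ω : Osbb C}
    {r s : Root C} (hx : x.1 = .mk (.block xs y z ω) r) (hs : s.Valid) {l : List (Shat C)}
    {p : D C} (hp : p ∈ osbbBlockSpan xs.length l)
    (hc : (l.map fun x : Shat C => x.1.content).sum + s.content = x.1.content)
    (hω : (l.map fun x : Shat C => x.1.content).sum.card = (Osbb.block xs y z ω).content.card)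
    (hl : l.length = (Osbb.block xs y z ω).length) :
    act p s.eval ∈ lowSpan x := by
  refine map_mem_of_mem_span (act.flip s.eval) ?_ hp
  rintro _ ⟨xs', y', z', η, h1, h2, h3, rfl⟩
  have h4 := content_eq_of_perm h3
  have h5 := length_eq_of_perm h3
  rw [← h4] at hc hω
  rw [← h5] at hl
  have h6 : (Expr.mk (.block xs' y' z' η) s).eval =
      act.flip s.eval (Osbb.block xs' y' z' η).eval := by rw [Expr.eval]; rfl
  rw [← h6]
  refine eval_mem_lowSpan ⟨h1, hs⟩ hc ?_
  rw [hx]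
  exact Expr.lt_of_blockLt (by rw [← hx, ← hc, Expr.content]) hω hl (by
    rw [Osbb.blockLt]; exact .inl (.inl h2))

/-- The right factor `p` is arbitrary, so it is rewritten in words of elements of `Ŝ`. Straightening
the whole product then keeps the first symmetric part below `j` letters. -/
lemma mul_eval_mem_osbbBlockSpan {j : ℕ} {l : List (Shat C)} {q : D C}
    (hq : q ∈ symBracketSpan incS j l) {s : Root C} {Q : Submodule ℝ (A C)} {μ : Multiset C} {k : ℕ}
    {p : D C} (hp : p ∈ homD μ k)
    (h : ∀ v : List (Shat C), (v.map fun x => x.1.content).sum = μ → v.length = k →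
      ∀ p' ∈ osbbBlockSpan j (l ++ v), act p' s.eval ∈ Q) : act (q * p) s.eval ∈ Q := by
  refine map_mem_of_mem_span ((act.flip s.eval).comp (LinearMap.mulLeft ℝ q)) ?_
    (homD_le_shatWordSpan μ k hp)
  rintro _ ⟨v, rfl, rfl, rfl⟩
  exact h v rfl rfl _ (blockSpan_le_osbbBlockSpan _ _
    (symBracketSpan_le_blockSpan _ _ (symBracketSpan_mul_mem v hq)))

lemma content_block_ofList (l : List (Shat C)) (y z : Shat C) (ω : Osbb C) :
    (Osbb.block (.ofList (l.map Subtype.val)) y.1 z.1 ω).content =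
      (l.map fun x : Shat C => x.1.content).sum + y.1.content + z.1.content + ω.content := by
  rw [Osbb.content, Exprs.content_eq, Exprs.toList_ofList, List.map_map]; rfl

lemma length_ofList (l : List (Shat C)) :
    (Exprs.ofList (l.map Subtype.val)).length = l.length := by
  rw [← Exprs.length_toList, Exprs.toList_ofList, List.length_map]

end

noncomputable section

variable {C : Type u} [LinearOrder C]

lemma content_sym_ofList (l : List (Shat C)) :
    (Osbb.sym (.ofList (l.map Subtype.val))).content =
      (l.map fun x : Shat C => x.1.content).sum := by
  rw [Osbb.content, Exprs.content_eq, Exprs.toList_ofList, List.map_map]; rfl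

lemma pairwise_of_valid {l : List (Shat C)}
    (h : (Exprs.ofList (l.map Subtype.val)).toList.Pairwise (fun a b => b.le a)) :
    l.Pairwise (fun x y => y ≤ x) := by
  rw [Exprs.toList_ofList, List.pairwise_map] at h
  exact h.imp fun h => Expr.le_iff.1 h

lemma Expr.lt_of_root_lt {ω : Osbb C} {r s : Root C} (hc : s.content = r.content) (h : s.lt r) :
    (Expr.mk ω s).lt (.mk ω r) := by
  have := congrArg Multiset.card hc
  rw [Root.card_content, Root.card_content] at this
  rw [Expr.lt]
  exact .inr ⟨by rw [Expr.vert, Expr.vert, this], .inr (.inr ⟨rfl, h⟩)⟩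

/-- A symmetric word may be sorted freely. The sorted list is still pointwise below `l`, hence
lexicographically smaller unless it equals `l`; in that case `l'` was `l` already, and the root must
have dropped. -/
lemma act_symList_mem_lowSpan {x : Shat C} {l l' : List (Shat C)} {r s : Root C}
    (hx : x.1 = .mk (.sym (.ofList (l.map Subtype.val))) r) (hl : l' ∈ belowList l)
    (hs : s ∈ belowRoot r) (hne : l' ≠ l ∨ s ≠ r) :
    act (symList (l'.map incS)) s.eval ∈ lowSpan x := by
  have hv := x.2
  rw [hx] at hv
  have hsort := pairwise_of_valid hv.1.2
  have hp := List.perm_insertionSort (fun x y : Shat C => y ≤ x) l'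
  obtain ⟨h1, h2⟩ := insertionSort_le (hl.imp fun _ _ h => h.2) hsort
  have h3 := List.pairwise_insertionSort (fun x y : Shat C => y ≤ x) l'
  have h4 := h1.length_eq
  rw [← symList_perm (hp.map incS), ← eval_sym_ofList]
  have hm := (hp.map fun x : Shat C => x.1.content).sum_eq
  rw [content_of_mem_belowList hl] at hm
  generalize l'.insertionSort (fun x y => y ≤ x) = m at *
  have h5 : (Expr.mk (.sym (.ofList (m.map Subtype.val))) s).eval =
    act (Osbb.sym (.ofList (m.map Subtype.val))).eval s.eval := by rw [Expr.eval]
  rw [← h5]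
  have hc : (Osbb.sym (.ofList (m.map Subtype.val))).content =
      (Osbb.sym (.ofList (l.map Subtype.val))).content := by
    rw [content_sym_ofList, content_sym_ofList, hm]
  have hc' : (Expr.mk (.sym (.ofList (m.map Subtype.val))) s).content =
      (Expr.mk (.sym (.ofList (l.map Subtype.val))) r).content := by
    rw [Expr.content, Expr.content, hc, hs.2.1]
  refine eval_mem_lowSpan ⟨pairwise_ofList h3, hs.1⟩ (by rw [hx, hc']) ?_
  rw [hx]
  by_cases hml : m = l
  · subst hml
    refine Expr.lt_of_root_lt hs.2.1 (hs.2.2.resolve_left ?_)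
    exact hne.resolve_left (not_not.2 (h2 rfl))
  · refine Expr.lt_of_blockLt hc' (by rw [hc]) ?_ ?_
    · rw [Osbb.length, Osbb.length, length_ofList, length_ofList, h4]
    · rw [Osbb.blockLt]
      exact .inr ⟨by rw [length_ofList, length_ofList, h4], lexLt_of_forall₂ h1 hml⟩

/-- Lower terms that arise by lowering the letters of the first block, the remaining block word, or
the root. -/
lemma act_block_mem_lowSpan {x : Shat C} {l l' : List (Shat C)} {y z y' z' : Shat C} {ω η : Osbb C}
    {r s : Root C} (hx : x.1 = .mk (.block (.ofList (l.map Subtype.val)) y.1 z.1 ω) r)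
    (hl : l' ∈ belowList l) (hy : y' ∈ below y) (hz : z' ∈ below z) (hη : η.Valid) (hs : s.Valid)
    (hc : η.content + s.content = ω.content + r.content)
    (hcard : η.content.card = ω.content.card) (hlen : η.length = ω.length)
    (hlt : l' ≠ l ∨ y' ≠ y ∨ z' ≠ z ∨ η.blockLt ω ∨ (η = ω ∧ s.lt r)) :
    act (symList (l'.map incS) * comm y'.1.eval z'.1.eval * η.eval) s.eval ∈ lowSpan x := by
  have hv := x.2
  rw [hx] at hv
  have hsort := pairwise_of_valid hv.1.1.2
  have hll := length_of_mem_belowList hl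
  have hlc := content_of_mem_belowList hl
  have hcomm : comm y'.1.eval z'.1.eval = incS y' * incS z' - incS z' * incS y' := rfl
  -- contents and lengths of words with the letters of `l'`, `y'`, `z'` and as many as `η`
  have hcontent {m : List (Shat C)} (hm : m.Perm (l' ++ [y', z'])) :
      (m.map fun x : Shat C => x.1.content).sum =
        (l.map fun x : Shat C => x.1.content).sum + y.1.content + z.1.content := by
    rw [(hm.map fun x : Shat C => x.1.content).sum_eq]
    simp only [List.map_append, List.sum_append, hlc, List.map_cons, List.map_nil, List.sum_cons,
      List.sum_nil, hy.1, hz.1, add_zero, add_assoc]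
  have hxc : x.1.content = (l.map fun x : Shat C => x.1.content).sum + y.1.content +
      z.1.content + η.content + s.content := by
    rw [hx, Expr.content, content_block_ofList]
    simp only [add_assoc, hc]
  -- comparison of two block words that begin with blocks of the same length
  have hblock {u : List (Shat C)} {a b : Shat C} (hb : IsBlock u a b)
      (hp : (u ++ [a, b]).Perm (l' ++ [y', z']))
      (h : (Osbb.block (.ofList (u.map Subtype.val)) a.1 b.1 η).blockLt
        (.block (.ofList (l.map Subtype.val)) y.1 z.1 ω) ∨ (u = l ∧ a = y ∧ b = z ∧ η = ω ∧
          s.lt r)) :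
      act (symList (u.map incS) * (incS a * incS b - incS b * incS a) * η.eval) s.eval ∈
        lowSpan x := by
    have h5 : (Expr.mk (.block (.ofList (u.map Subtype.val)) a.1 b.1 η) s).eval =
      act (Osbb.block (.ofList (u.map Subtype.val)) a.1 b.1 η).eval s.eval := by rw [Expr.eval]
    rw [← eval_block_ofList, ← h5]
    have h6 := hcontent hp
    simp only [List.map_append, List.sum_append, List.map_cons, List.map_nil, List.sum_cons,
      List.sum_nil, add_zero] at h6
    rw [← add_assoc] at h6
    refine eval_mem_lowSpan ⟨valid_block hb hη, hs⟩ ?_ ?_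
    · rw [Expr.content, content_block_ofList, hxc, h6]
    · rw [hx]
      rcases h with h | ⟨rfl, rfl, rfl, rfl, h⟩
      · have h7 := hp.length_eq
        simp only [List.length_append, List.length_cons, List.length_nil] at h7
        refine Expr.lt_of_blockLt ?_ ?_ ?_ h
        · rw [← hx, Expr.content, content_block_ofList, hxc, h6]
        · rw [content_block_ofList, content_block_ofList, h6, Multiset.card_add, hcard,
            ← Multiset.card_add]
        · rw [Osbb.length, Osbb.length, length_ofList, length_ofList, hlen]
          omega
      · exact Expr.lt_of_root_lt (add_left_cancel hc) h
  rw [hcomm]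
  -- For equal sizes of the symmetric parts the order looks first at the lower bracket letter, so
  -- what matters is whether some letter has fallen below `z`.
  by_cases hmin : ∀ m ∈ l' ++ [y', z'], z ≤ m
  · obtain rfl : z' = z := le_antisymm hz.2 (hmin z' (by simp))
    rcases (hmin y' (by simp)).eq_or_lt with rfl | hzy
    -- If lowering has made both bracket letters equal, the bracket vanishes.
    · simp
    have hp := List.perm_insertionSort (fun x y : Shat C => y ≤ x) l'
    obtain ⟨h1, h2⟩ := insertionSort_le (hl.imp fun _ _ h => h.2) hsort
    have h3 := List.pairwise_insertionSort (fun x y : Shat C => y ≤ x) l'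
    rw [← symList_perm (hp.map incS)]
    generalize l'.insertionSort (fun x y => y ≤ x) = m at *
    refine hblock ⟨h3, hzy, fun a ha => hmin a (by simp [hp.mem_iff.1 ha])⟩
      (hp.append_right _) ?_
    have hml : (Exprs.ofList (m.map Subtype.val)).length =
      (Exprs.ofList (l.map Subtype.val)).length := by
      rw [length_ofList, length_ofList, h1.length_eq]
    rw [Osbb.blockLt]
    rcases hy.2.lt_or_eq with h | rfl
    · exact .inl (.inl (.inr ⟨hml, .inr ⟨rfl, .inl h⟩⟩))
    by_cases hm : m = l
    · obtain rfl := h2 hm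
      subst hm
      rcases hlt with h | h | h | h | h
      · exact absurd rfl h
      · exact absurd rfl h
      · exact absurd rfl h
      · exact .inl (.inr ⟨rfl, rfl, rfl, h⟩)
      · exact .inr ⟨rfl, rfl, rfl, h⟩
    · exact .inl (.inl (.inr ⟨hml, .inr ⟨rfl, .inr ⟨rfl, lexLt_of_forall₂ h1 hm⟩⟩⟩))
  -- Straightening puts a letter `b ≤ m < z` into the lower slot of every block of full size, which
  -- is then smaller whatever the other letters are. The errors have a shorter symmetric part and
  -- are smaller by the first comparison.
  · push Not at hmin
    obtain ⟨m, hm, hmz⟩ := hmin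
    obtain ⟨p, hp, q, hq, hpq⟩ := Submodule.mem_sup.1 (straighten (f := incS) l' y' z')
    rw [← hpq, add_mul, map_add, LinearMap.add_apply]
    refine add_mem ?_ ?_
    · refine map_mem_of_mem_span ((act.flip s.eval).comp (LinearMap.mulRight ℝ η.eval)) ?_ hp
      rintro _ ⟨u, a, b, hb, h1, h2, rfl⟩
      refine hblock hb h2 (.inl ?_)
      have hbm : b ≤ m := by
        have := h2.mem_iff.2 hm
        simp only [List.mem_append, List.mem_cons, List.not_mem_nil, or_false] at this
        rcases this with h | rfl | rfl
        · exact hb.2.2 m h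
        · exact hb.2.1.le
        · exact le_rfl
      rw [Osbb.blockLt]
      exact .inl (.inr ⟨by rw [length_ofList, length_ofList, h1, hll],
        .inl (hbm.trans_lt hmz)⟩)
    · refine mul_eval_mem_osbbBlockSpan hq η.eval_mem fun v h1 h2 p' hp' => ?_
      have h3 := hcontent (List.Perm.refl _)
      refine act_mem_lowSpan_of_osbbBlockSpan hx hs (l := l' ++ [y', z'] ++ v)
        (by rwa [length_ofList, ← hll]) ?_ ?_ ?_
      · rw [List.map_append, List.sum_append, h3, h1, hxc]
      · rw [List.map_append, List.sum_append, h3, h1, content_block_ofList, Multiset.card_add,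
          hcard, ← Multiset.card_add]
      · rw [Osbb.length, length_ofList, ← hlen, ← h2, List.length_append, List.length_append, hll]
        rfl

/-- The bracket of the tensor algebra as a bilinear map. -/
def commₗ : A C →ₗ[ℝ] A C →ₗ[ℝ] D C :=
  LinearMap.mk₂ ℝ comm (fun a b c => by simp only [comm, map_add]; noncomm_ring)
    (fun a b c => by simp [comm, smul_sub])
    (fun a b c => by simp only [comm, map_add]; noncomm_ring)
    (fun a b c => by simp [comm, smul_sub])

/-- The first alternative, where the word loses vertices or letters, needs no inspection of blocks.
Only in the second must the first block be straightened and compared. The root may trade generators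
with the word, so only the cardinalities of the word contents are compared. -/
lemma le_cases {ω η : Osbb C} {r s : Root C} (hc : (Expr.mk η s).content = (Expr.mk ω r).content)
    (h : (Expr.mk η s) ≤ .mk ω r) :
    (η.content.card < ω.content.card ∨
      (η.content.card = ω.content.card ∧ η.length < ω.length)) ∨
    (η.content.card = ω.content.card ∧ η.length = ω.length ∧
      (η.blockLt ω ∨ (η = ω ∧ (s = r ∨ s.lt r)))) := by
  have hv := congrArg Multiset.card hc
  rw [Expr.card_content, Expr.card_content] at hv
  rw [η.card_content, ω.card_content]
  rcases h.lt_or_eq with h | h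
  · rw [← Expr.lt_iff, Expr.lt] at h
    rcases h with h | ⟨_, h | ⟨h1, h2 | ⟨h2, h3⟩⟩ | ⟨rfl, h'⟩⟩
    · omega
    · exact .inl (.inl h)
    · exact .inl (.inr ⟨h1, h2⟩)
    · exact .inr ⟨h1, h2, .inl h3⟩
    · exact .inr ⟨rfl, rfl, .inr ⟨rfl, .inr h'⟩⟩
  · rw [Expr.mk.injEq] at h
    obtain ⟨rfl, rfl⟩ := h
    exact .inr ⟨rfl, rfl, .inr ⟨rfl, .inl rfl⟩⟩

/-- The composition of the first block with the remaining expression, up to lower terms. -/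
lemma act_act_sub_mem_lowSpan {x e : Shat C} {l l' : List (Shat C)} {y z y' z' : Shat C}
    {ω η : Osbb C} {r s : Root C}
    (hx : x.1 = .mk (.block (.ofList (l.map Subtype.val)) y.1 z.1 ω) r)
    (hl : l' ∈ belowList l) (hy : y' ∈ below y) (hz : z' ∈ below z) (he : e.1 = .mk η s)
    (hc : e.1.content = (Expr.mk ω r).content) (hle : e.1 ≤ .mk ω r) :
    act (symList (l'.map incS)) (act (comm y'.1.eval z'.1.eval) e.1.eval) -
      act (symList (l'.map incS) * comm y'.1.eval z'.1.eval * η.eval) s.eval ∈ lowSpan x := by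
  have hev := e.2
  rw [he] at hev hc hle ⊢
  rw [Expr.eval]
  have h1 := symList_mem_homD (f := incS) (c := fun x : Shat C => x.1.content) l'
    fun x _ => inc_mem_homD x.1.eval_mem
  have h2 := comm_mem_homD y'.1.eval_mem z'.1.eval_mem
  obtain ⟨p, hp, h⟩ := exists_act_act_act_eq h1 h2 η.eval_mem
  rw [h, add_sub_cancel_left]
  refine act_mem_of_mem_lowD hp fun j hj q hq => act_mem_lowSpan_of_lt hx hev.2 hq ?_ ?_
  · rw [hx, content_of_mem_belowList hl, hy.1, hz.1, Expr.content, content_block_ofList]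
    rw [Expr.content, Expr.content] at hc
    simp only [add_assoc, hc]
  · rw [length_of_mem_belowList hl] at hj
    rw [content_of_mem_belowList hl, hy.1, hz.1, content_block_ofList, Osbb.length, length_ofList]
    simp only [Multiset.card_add]
    -- The correction is strictly shorter than the merged word, and `η` has fewer vertices than `ω`,
    -- or as many vertices and no more letters.
    rcases le_cases hc hle with (h | h) | h <;> omega

lemma act_act_mem_lowSpan {x e : Shat C} {l l' : List (Shat C)} {y z y' z' : Shat C}
    {ω : Osbb C} {r : Root C}
    (hx : x.1 = .mk (.block (.ofList (l.map Subtype.val)) y.1 z.1 ω) r)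
    (hl : l' ∈ belowList l) (hy : y' ∈ below y) (hz : z' ∈ below z)
    (hc : e.1.content = (Expr.mk ω r).content) (hle : e.1 ≤ .mk ω r)
    (hne : l' ≠ l ∨ y' ≠ y ∨ z' ≠ z ∨ e.1 ≠ .mk ω r) :
    act (symList (l'.map incS)) (act (comm y'.1.eval z'.1.eval) e.1.eval) ∈ lowSpan x := by
  obtain ⟨η, s, he⟩ : ∃ η s, e.1 = .mk η s := by
    cases h : e.1 with
    | mk η s => exact ⟨η, s, rfl⟩
  have h := act_act_sub_mem_lowSpan hx hl hy hz he hc hle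
  have hev := e.2
  rw [he] at hev hc hle hne
  rw [← sub_add_cancel (act (symList (l'.map incS)) (act (comm y'.1.eval z'.1.eval) e.1.eval))
    (act (symList (l'.map incS) * comm y'.1.eval z'.1.eval * η.eval) s.eval)]
  refine add_mem h ?_
  rcases le_cases hc hle with h1 | ⟨h1, h2, h3⟩
  · have h4 := symList_mem_homD (f := incS) (c := fun x : Shat C => x.1.content) l'
      fun x _ => inc_mem_homD x.1.eval_mem
    have h5 := mul_mem_homD (mul_mem_homD h4 (comm_mem_homD y'.1.eval_mem z'.1.eval_mem)) η.eval_mem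
    refine act_mem_lowSpan_of_lt hx hev.2 h5 ?_ ?_
    · rw [hx, content_of_mem_belowList hl, hy.1, hz.1, Expr.content, content_block_ofList]
      rw [Expr.content, Expr.content] at hc
      simp only [add_assoc, hc]
    · rw [content_of_mem_belowList hl, hy.1, hz.1, content_block_ofList, Osbb.length, length_ofList,
        length_of_mem_belowList hl]
      simp only [Multiset.card_add]
      omega
  · refine act_block_mem_lowSpan hx hl hy hz hev.1 hev.2
      (by rwa [Expr.content, Expr.content] at hc) h1 h2 ?_
    rcases hne with h | h | h | h
    · exact .inl h
    · exact .inr (.inl h)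
    · exact .inr (.inr (.inl h))
    · refine .inr (.inr (.inr (h3.imp_right fun h' => ⟨h'.1, h'.2.resolve_left ?_⟩)))
      rintro rfl
      exact h (by rw [h'.1])

/-- Bilinearity of the bracket, together with the lexicographic order: lowering either entry lowers
the bracket. -/
lemma root_phi_sub_mem (r : Root C) (hr : r.Valid)
    (h : ∀ x : Shat C, x.1.vert < r.vert → x.1.phi - x.1.eval ∈ lowSpan x) :
    r.phi - r.eval ∈ Submodule.span ℝ (Root.eval '' (belowRoot r \ {r})) := by
  cases r with
  | gen c => rw [Root.phi, Root.eval, sub_self]; exact Submodule.zero_mem _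
  | brk u v =>
    have hu := u.vert_pos
    have hv := v.vert_pos
    rw [Root.vert] at h
    have h1 := map₂_sub_mem_span brk (self_mem_below _) (self_mem_below _)
      (h ⟨u, hr.1⟩ (by change u.vert < _; omega)) (h ⟨v, hr.2⟩ (by change v.vert < _; omega))
    rw [Root.phi, Root.eval]
    refine Submodule.span_mono ?_ h1
    rintro _ ⟨⟨u', v'⟩, ⟨⟨hu', hv'⟩, hne⟩, rfl⟩
    have hle1 : u'.1 ≤ u := hu'.2
    have hle2 : v'.1 ≤ v := hv'.2
    refine ⟨.brk u'.1 v'.1, ⟨⟨⟨u'.2, v'.2⟩, ?_, ?_⟩, ?_⟩, by rw [Root.eval]⟩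
    · rw [Root.content, Root.content, hu'.1, hv'.1]
    · rw [Root.brk.injEq, Root.lt]
      rcases hle1.lt_or_eq with h1 | h1
      · exact .inr (.inl h1)
      · rcases hle2.lt_or_eq with h2 | h2
        · exact .inr (.inr ⟨h1, h2⟩)
        · exact .inl ⟨h1, h2⟩
    · intro h
      rw [Set.mem_singleton_iff, Root.brk.injEq] at h
      exact hne (Prod.ext (Subtype.ext h.1) (Subtype.ext h.2))

/-- The map `φ` is unitriangular. -/
theorem phi_sub_eval_mem (x : Shat C) : x.1.phi - x.1.eval ∈ lowSpan x := by
  induction hn : x.1.vert using Nat.strong_induction_on generalizing x with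
  | _ n ih =>
    have ih' (y : Shat C) (hy : y.1.vert < n) : y.1.phi - y.1.eval ∈ lowSpan y := ih _ hy y rfl
    clear ih
    obtain ⟨⟨ω, r⟩, hω, hr⟩ := x
    change (Expr.mk ω r).vert = n at hn
    rw [Expr.vert] at hn
    have hr0 := r.vert_pos
    change (Expr.mk ω r).phi - (Expr.mk ω r).eval ∈ _
    cases ω with
    | sym xs =>
      obtain ⟨l, rfl⟩ := xs.exists_eq_ofList hω.1
      rw [Expr.phi_sym, Expr.eval, eval_sym_ofList, symWord_get, Exprs.phi_eq, Exprs.toList_ofList,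
        List.map_map, List.map_map]
      have hl : ∀ x ∈ l, x.1.vert < n := fun x hx => by
        have := Osbb.vert_le_of_mem_letters (ω := .sym (.ofList (l.map Subtype.val))) (x := x.1)
          (by rw [Osbb.letters, Exprs.toList_ofList]; exact List.mem_map_of_mem hx)
        omega
      have h1 := symList_phi_sub_mem l fun x hx => ih' x (hl x hx)
      have h2 := root_phi_sub_mem r hr fun x hx => ih' x (by omega)
      have h3 := map₂_sub_mem_span act (self_mem_belowList l)
        (show r ∈ belowRoot r from ⟨hr, rfl, .inl rfl⟩) h1 h2
      refine Submodule.span_le.2 ?_ h3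
      rintro _ ⟨⟨l', s⟩, ⟨⟨hl', hs⟩, hne⟩, rfl⟩
      refine act_symList_mem_lowSpan rfl hl' hs ?_
      by_contra hcon
      push Not at hcon
      exact hne (Prod.ext hcon.1 hcon.2)
    | block xs y z ω =>
      obtain ⟨l, rfl⟩ := xs.exists_eq_ofList hω.1.1
      obtain ⟨y, rfl⟩ : ∃ y' : Shat C, y'.1 = y := ⟨⟨y, hω.2.1.1⟩, rfl⟩
      obtain ⟨z, rfl⟩ : ∃ z' : Shat C, z'.1 = z := ⟨⟨z, hω.2.1.2.1⟩, rfl⟩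
      obtain ⟨e, he⟩ : ∃ e : Shat C, e.1 = .mk ω r := ⟨⟨.mk ω r, hω.2.2, hr⟩, rfl⟩
      rw [Expr.phi_block, ← act_comm, ← he, symWord_get, Exprs.phi_eq, Exprs.toList_ofList,
        List.map_map, List.map_map]
      have hmem (x : Shat C) (hx : x ∈ l ∨ x = y ∨ x = z) : x.1.vert < n := by
        have := Osbb.vert_le_of_mem_letters
          (ω := .block (.ofList (l.map Subtype.val)) y.1 z.1 ω) (x := x.1)
          (by
            rw [Osbb.letters, Exprs.toList_ofList]
            rcases hx with h | rfl | rfl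
            · exact List.mem_append_left _ (List.mem_map_of_mem h)
            · simp
            · simp)
        omega
      have hev : e.1.vert < n := by
        have := y.1.vert_pos
        rw [he, Expr.vert]
        rw [Osbb.vert] at hn
        omega
      have h1 := symList_phi_sub_mem l fun x hx => ih' x (hmem x (.inl hx))
      have h2 := map₂_sub_mem_span commₗ (self_mem_below y) (self_mem_below z)
        (ih' y (hmem y (by simp))) (ih' z (hmem z (by simp)))
      have h3 := map₂_sub_mem_span act (f := fun p : Shat C × Shat C => commₗ p.1.1.eval p.2.1.eval)
        (show (y, z) ∈ below y ×ˢ below z from ⟨self_mem_below y, self_mem_below z⟩)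
        (self_mem_below e) h2 (ih' e hev)
      have h4 := map₂_sub_mem_span act (self_mem_belowList l)
        (g := fun p : (Shat C × Shat C) × Shat C => act (commₗ p.1.1.1.eval p.1.2.1.eval) p.2.1.eval)
        (show ((y, z), e) ∈ (below y ×ˢ below z) ×ˢ below e from
          ⟨⟨self_mem_below y, self_mem_below z⟩, self_mem_below e⟩) h1 h3
      have h5 := act_act_sub_mem_lowSpan
        (x := ⟨.mk (.block (.ofList (l.map Subtype.val)) y.1 z.1 ω) r, hω, hr⟩) rfl
        (self_mem_belowList l) (self_mem_below y) (self_mem_below z) he (by rw [he]) (by rw [he])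
      -- Pass through `𝔰(l) ▷ ([y, z] ▷ e)`, with `φ` removed from every argument. The first
      -- difference comes from lowered arguments, the second from merging the compositions into one
      -- word.
      rw [← sub_add_sub_cancel _
        (act (symList (l.map incS)) (act (comm y.1.eval z.1.eval) e.1.eval))]
      refine add_mem (Submodule.span_le.2 ?_ h4) ?_
      · rintro _ ⟨⟨l', ⟨y', z'⟩, e'⟩, ⟨⟨hl', ⟨hy', hz'⟩, he'⟩, hne⟩, rfl⟩
        refine act_act_mem_lowSpan rfl hl' hy' hz' (by rw [← he]; exact he'.1)
          (by rw [← he]; exact he'.2) ?_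
        by_contra hcon
        push Not at hcon
        obtain ⟨k1, k2, k3, k4⟩ := hcon
        exact hne (Prod.ext k1 (Prod.ext (Prod.ext k2 k3) (Subtype.ext (k4.trans he.symm))))
      · convert h5 using 2
        rw [Expr.eval, eval_block_ofList]
        rfl

end

/-! ### The bases `Ŝ` and `𝒯`, and the map `φ` -/

noncomputable section

variable {C : Type u} [LinearOrder C]

lemma phi_mem_homA (x : Shat C) : x.1.phi ∈ homA x.1.content := by
  rw [← sub_add_cancel x.1.phi x.1.eval]
  refine add_mem (Submodule.span_le.2 ?_ (phi_sub_eval_mem x)) x.1.eval_mem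
  rintro _ ⟨y, hy, rfl⟩
  rw [SetLike.mem_coe, ← hy.1.1]
  exact y.1.eval_mem

/-- This inverts the unitriangular relation. Fixing the content leaves a finite set, on which `≺` is
well-founded although the order of `C` is arbitrary. -/
lemma eval_mem_span_phi (x : Shat C) : x.1.eval ∈
    Submodule.span ℝ {a | ∃ y : Shat C, y.1.content = x.1.content ∧ y.1.phi = a} := by
  have hfin : {y : Shat C | y.1.content = x.1.content}.Finite :=
    Shat.finite_content_mem (Set.finite_singleton x.1.content)
  have hwf := hfin.wellFoundedOn (r := fun y z : Shat C => y < z)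
  refine hwf.induction (P := fun x' : Shat C => x'.1.eval ∈
    Submodule.span ℝ {a | ∃ y : Shat C, y.1.content = x.1.content ∧ y.1.phi = a})
    (show x ∈ {y : Shat C | y.1.content = x.1.content} from rfl) fun y hy ih => ?_
  rw [← sub_sub_cancel y.1.phi y.1.eval]
  refine sub_mem (Submodule.subset_span ⟨y, hy, rfl⟩) (Submodule.span_le.2 ?_ (phi_sub_eval_mem y))
  rintro _ ⟨z, hz, rfl⟩
  exact ih z (hz.1.1.trans hy) (lt_of_le_of_ne hz.1.2 hz.2)

lemma single_mem_span_phi (m : Mon C) : Finsupp.single m 1 ∈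
    Submodule.span ℝ {a | ∃ x : Shat C, x.1.content = m.content ∧ x.1.phi = a} := by
  refine Submodule.span_le.2 ?_ (single_mem_shatSpan m)
  rintro _ ⟨x, hx, rfl⟩
  rw [← hx]
  exact eval_mem_span_phi x

theorem linearIndependent_eval : LinearIndependent ℝ fun x : Shat C => x.1.eval :=
  linearIndependent_of_span _ single_mem_shatSpan

theorem linearIndependent_phi : LinearIndependent ℝ fun x : Shat C => x.1.phi :=
  linearIndependent_of_span _ single_mem_span_phi

theorem span_range_eval : Submodule.span ℝ (Set.range fun x : Shat C => x.1.eval) = ⊤ :=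
  span_eq_top fun m => Submodule.span_mono (by rintro _ ⟨x, _, rfl⟩; exact ⟨x, rfl⟩)
    (single_mem_shatSpan m)

theorem span_range_phi : Submodule.span ℝ (Set.range fun x : Shat C => x.1.phi) = ⊤ :=
  span_eq_top fun m => Submodule.span_mono (by rintro _ ⟨x, _, rfl⟩; exact ⟨x, rfl⟩)
    (single_mem_span_phi m)

lemma phi_injective : Function.Injective fun x : Shat C => x.1.phi :=
  linearIndependent_phi.injective

/-- The basis `Ŝ` of `A`. -/
def evalBasis : Module.Basis (Shat C) ℝ (A C) :=
  Module.Basis.mk linearIndependent_eval span_range_eval.ge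

/-- The basis `φ(Ŝ)` of `A`. -/
def phiBasis : Module.Basis (Shat C) ℝ (A C) :=
  Module.Basis.mk linearIndependent_phi span_range_phi.ge

/-- The automorphism `φ`. -/
def phiEquiv : A C ≃ₗ[ℝ] A C := evalBasis.equiv phiBasis (Equiv.refl _)

lemma phiEquiv_eval (x : Shat C) : phiEquiv x.1.eval = x.1.phi := by
  have h := evalBasis.equiv_apply x phiBasis (Equiv.refl _)
  rwa [evalBasis, Module.Basis.mk_apply, phiBasis, Equiv.refl_apply, Module.Basis.mk_apply] at h

/-! #### The set `𝒯` -/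

mutual

lemma Expr.memT_phi : (x : Expr C) → x.Valid → MemT x.phi
  | .mk (.sym xs) (.gen c), hx => by
    have h := xs.memT_phi hx.1.1
    rw [Expr.phi_sym, Root.phi]
    exact .symGen _ _ c fun i => h _ (List.get_mem _ i)
  | .mk (.sym xs) (.brk u v), hx => by
    have h := xs.memT_phi hx.1.1
    rw [Expr.phi_sym, Root.phi]
    exact .symBrk _ _ _ _ (fun i => h _ (List.get_mem _ i)) (u.memT_phi hx.2.1)
      (v.memT_phi hx.2.2)
  | .mk (.block xs y z ω) r, hx => by
    have h := xs.memT_phi hx.1.1.1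
    have hy := hx.1.2.1
    rw [Expr.phi_block]
    refine .symTriple _ _ _ _ _ (fun i => h _ (List.get_mem _ i)) (y.memT_phi hy.1)
      (z.memT_phi hy.2.1) ((Expr.mk ω r).memT_phi ⟨hx.1.2.2, hx.2⟩)
      ⟨⟨z, hy.2.1⟩, ⟨y, hy.1⟩, rfl, rfl, hy.2.2.1⟩ fun i => ?_
    have hi := List.get_mem xs.phi i
    generalize xs.phi.get i = a at *
    rw [xs.phi_eq] at hi
    obtain ⟨x, hx', rfl⟩ := List.mem_map.1 hi
    rcases hy.2.2.2 x hx' with h | rfl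
    · exact .inl ⟨⟨z, hy.2.1⟩, ⟨x, xs.valid_iff.1 hx.1.1.1 x hx'⟩, rfl, rfl, h⟩
    · exact .inr rfl
termination_by x => sizeOf x

lemma Exprs.memT_phi : (xs : Exprs C) → xs.Valid → ∀ a ∈ xs.phi, MemT a
  | .nil, _ => by simp [Exprs.phi]
  | .cons x xs, hx => by
    simp only [Exprs.phi, List.mem_cons, forall_eq_or_imp]
    exact ⟨x.memT_phi hx.1, xs.memT_phi hx.2⟩
termination_by xs => sizeOf xs

end

/-- The rules of `𝒯` accept letters in any order, whereas valid expressions list them decreasingly;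
symmetrization does not see the difference. -/
lemma symWord_eq_symList {n : ℕ} (x : Fin n → Shat C) {a : Fin n → A C}
    (h : ∀ i, (x i).1.phi = a i) :
    ∃ l : List (Shat C), l.Pairwise (fun x y => y ≤ x) ∧ (∀ y ∈ l, ∃ i, y = x i) ∧
      symWord a = symWord (Exprs.ofList (l.map Subtype.val)).phi.get := by
  have hp := List.perm_insertionSort (fun x y : Shat C => y ≤ x) (List.ofFn x)
  refine ⟨_, List.pairwise_insertionSort (fun x y : Shat C => y ≤ x) (List.ofFn x), fun y hy => ?_,
    ?_⟩
  · obtain ⟨i, h⟩ := (List.mem_ofFn' _ _).1 (hp.mem_iff.1 hy)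
    exact ⟨i, h.symm⟩
  · have h1 : symWord a = symProd fun i => inc (a i) := rfl
    rw [h1, symProd_eq_symList, symWord_get, Exprs.phi_eq, Exprs.toList_ofList, List.map_map,
      List.map_map, symList_perm (hp.map _), List.map_ofFn]
    congr 2
    funext i
    simp [h]

lemma exists_phi_eq_of_memT {a : A C} (ha : MemT a) : ∃ x : Shat C, x.1.phi = a := by
  -- The rules of `𝒯` without a word correspond to the empty symmetric word, which acts as the
  -- identity.
  have hnil (r : Root C) : (Expr.mk (.sym .nil) r).phi = r.phi := by
    rw [Expr.phi_sym, symWord_get, Exprs.phi_eq, Exprs.toList]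
    simp [symList_nil, act_one]
  have hnv : (Osbb.sym (.nil : Exprs C)).Valid := ⟨trivial, List.Pairwise.nil⟩
  induction ha with
  | gen c => exact ⟨⟨.mk (.sym .nil) (.gen c), hnv, trivial⟩, by rw [hnil, Root.phi]⟩
  | brk u v _ _ hu hv =>
    obtain ⟨u, rfl⟩ := hu
    obtain ⟨v, rfl⟩ := hv
    exact ⟨⟨.mk (.sym .nil) (.brk u.1 v.1), hnv, u.2, v.2⟩, by rw [hnil, Root.phi]⟩
  | symGen n x c _ hx =>
    choose y hy using hx
    obtain ⟨l, h1, _, h3⟩ := symWord_eq_symList y hy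
    exact ⟨⟨.mk (.sym _) (.gen c), pairwise_ofList h1, trivial⟩, by
      rw [Expr.phi_sym, h3, Root.phi]⟩
  | symBrk n x u v _ _ _ hx hu hv =>
    obtain ⟨u, rfl⟩ := hu
    obtain ⟨v, rfl⟩ := hv
    choose y hy using hx
    obtain ⟨l, h1, _, h3⟩ := symWord_eq_symList y hy
    exact ⟨⟨.mk (.sym _) (.brk u.1 v.1), pairwise_ofList h1, u.2, v.2⟩, by
      rw [Expr.phi_sym, h3, Root.phi]⟩
  | symTriple n x y z w _ _ _ _ hzy hzx hx hy hz hw =>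
    obtain ⟨y, rfl⟩ := hy
    obtain ⟨z, rfl⟩ := hz
    obtain ⟨⟨⟨ω, r⟩, hω, hr⟩, rfl⟩ := hw
    choose x' hx' using hx
    obtain ⟨l, h1, h2, h3⟩ := symWord_eq_symList x' hx'
    -- The order on `𝒯` only asserts that some preimages are ordered; they are the given ones
    -- because `φ` is injective on `Ŝ`.
    have hlt {a b : Shat C} (h : ltT a.1.phi b.1.phi) : a < b := by
      obtain ⟨u, v, hu, hv, huv⟩ := h
      rw [← phi_injective hu, ← phi_injective hv]
      exact huv
    have hb : IsBlock l y z := ⟨h1, hlt hzy, fun m hm => by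
      obtain ⟨i, rfl⟩ := h2 m hm
      have := hzx i
      rw [← hx' i] at this
      rcases this with h | h
      · exact (hlt h).le
      · exact (phi_injective h).le⟩
    exact ⟨⟨.mk (.block _ y.1 z.1 ω) r, valid_block hb hω, hr⟩, by rw [Expr.phi_block, h3]⟩

theorem range_phi : (Set.range fun x : Shat C => x.1.phi) = T C :=
  Set.Subset.antisymm (Set.range_subset_iff.2 fun x => x.1.memT_phi x.2)
    fun _ ha => exists_phi_eq_of_memT ha

/-! #### The grading -/

lemma graded_le_span {i : ℕ} {v : Shat C → A C}
    (h : ∀ m : Mon C, Finsupp.single m 1 ∈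
      Submodule.span ℝ {a | ∃ x : Shat C, x.1.content = m.content ∧ v x = a}) :
    graded C i ≤ Submodule.span ℝ {a | ∃ x : Shat C, x.1.vert = i ∧ v x = a} := by
  rw [graded, Finsupp.supported_eq_span_single, Submodule.span_le]
  rintro _ ⟨m, hm, rfl⟩
  refine Submodule.span_mono ?_ (h m)
  rintro _ ⟨x, hx, rfl⟩
  refine ⟨x, ?_, rfl⟩
  rw [← x.1.card_content, hx, m.card_content]
  exact hm

theorem span_eval_eq_graded (i : ℕ) :
    Submodule.span ℝ {a | ∃ x : Shat C, x.1.vert = i ∧ x.1.eval = a} = graded C i := by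
  refine le_antisymm (Submodule.span_le.2 ?_) (graded_le_span single_mem_shatSpan)
  rintro _ ⟨x, hx, rfl⟩
  exact homA_le_graded (by rw [x.1.card_content, hx]) x.1.eval_mem

theorem span_phi_eq_graded (i : ℕ) :
    Submodule.span ℝ {a | ∃ x : Shat C, x.1.vert = i ∧ x.1.phi = a} = graded C i := by
  refine le_antisymm (Submodule.span_le.2 ?_) (graded_le_span single_mem_span_phi)
  rintro _ ⟨x, hx, rfl⟩
  exact homA_le_graded (by rw [x.1.card_content, hx]) (phi_mem_homA x)

theorem map_phiEquiv_graded (i : ℕ) :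
    (graded C i).map ((phiEquiv : A C ≃ₗ[ℝ] A C) : A C →ₗ[ℝ] A C) = graded C i := by
  conv_lhs => rw [← span_eval_eq_graded, Submodule.map_span]
  rw [← span_phi_eq_graded]
  congr 1
  ext a
  constructor
  · rintro ⟨_, ⟨x, hx, rfl⟩, rfl⟩
    exact ⟨x, hx, (phiEquiv_eval x).symm⟩
  · rintro ⟨x, hx, rfl⟩
    exact ⟨_, ⟨x, hx, rfl⟩, phiEquiv_eval x⟩

lemma lowSpan_le (x : Shat C) : lowSpan x ≤ Submodule.span ℝ
    {a | ∃ y : Shat C, y.1.vert = x.1.vert ∧ y.1.lt x.1 ∧ y.1.eval = a} := by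
  refine Submodule.span_mono ?_
  rintro _ ⟨y, hy, rfl⟩
  refine ⟨y, ?_, lt_of_le_of_ne hy.1.2 hy.2, rfl⟩
  rw [← y.1.card_content, hy.1.1, x.1.card_content]

end

end TwoOpAlg

theorem mainTheorem2 (C : Type*) [LinearOrder C] :
    -- `Ŝ` is a basis
    LinearIndependent ℝ (fun x : TwoOpAlg.Shat C => x.1.eval) ∧
    Submodule.span ℝ (Set.range fun x : TwoOpAlg.Shat C => x.1.eval) = ⊤ ∧
    -- `𝒯` is a basis
    LinearIndependent ℝ (fun t : TwoOpAlg.T C => (t : TwoOpAlg.A C)) ∧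
    Submodule.span ℝ (TwoOpAlg.T C) = ⊤ ∧
    -- the map `φ`
    ∃ φ : TwoOpAlg.A C ≃ₗ[ℝ] TwoOpAlg.A C,
      (∀ x : TwoOpAlg.Shat C, φ x.1.eval = x.1.phi) ∧
      -- `φ` preserves the graded pieces, on which it is upper-triangular with unit diagonal
      (∀ i : ℕ, Submodule.span ℝ {a | ∃ x : TwoOpAlg.Shat C, x.1.vert = i ∧ x.1.eval = a} =
        TwoOpAlg.graded C i) ∧
      (∀ i : ℕ, (TwoOpAlg.graded C i).map (φ : TwoOpAlg.A C →ₗ[ℝ] TwoOpAlg.A C) =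
        TwoOpAlg.graded C i) ∧
      (∀ x : TwoOpAlg.Shat C, φ x.1.eval - x.1.eval ∈ Submodule.span ℝ
        {a | ∃ y : TwoOpAlg.Shat C, y.1.vert = x.1.vert ∧ y.1.lt x.1 ∧ y.1.eval = a}) ∧
      -- `φ` restricts to a bijection from `Ŝ` onto `𝒯`
      Set.BijOn φ (Set.range fun x : TwoOpAlg.Shat C => x.1.eval) (TwoOpAlg.T C) := by
  refine ⟨TwoOpAlg.linearIndependent_eval, TwoOpAlg.span_range_eval, ?_, ?_, TwoOpAlg.phiEquiv,
    TwoOpAlg.phiEquiv_eval, TwoOpAlg.span_eval_eq_graded, TwoOpAlg.map_phiEquiv_graded,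
    fun x => ?_, ?_⟩
  · rw [← TwoOpAlg.range_phi]
    exact TwoOpAlg.linearIndependent_phi.linearIndepOn_id
  · rw [← TwoOpAlg.range_phi, TwoOpAlg.span_range_phi]
  · rw [TwoOpAlg.phiEquiv_eval]
    exact TwoOpAlg.lowSpan_le x (TwoOpAlg.phi_sub_eval_mem x)
  · rw [← TwoOpAlg.range_phi]
    convert (TwoOpAlg.phiEquiv (C := C)).injective.injOn.bijOn_image using 1
    rw [← Set.range_comp]
    exact congrArg Set.range (funext fun x => (TwoOpAlg.phiEquiv_eval x).symm)
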